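/- Fix $M>0$. Describe the Kruskal extension of the Schwarzschild spacetime of mass $M$ by null coordinates $(U,V)$ with $UV>-2M$ (each point standing for a round sphere), where the area radius $r>0$ is determined by $(r-2M)e^{r/2M}=UV$, the metric is $\frac{16M^2e^{-r/2M}}{r}\,dU\,dV+r^2(d\theta^2+\sin^2\theta\,d\phi^2)$, and $\partial_T=\partial_V-\partial_U$ is future directed. Region II is $\{U<0<V\}$ and region II' is $\{V<0<U\}$. A spherically symmetric hypersurface is a curve in the $(U,V)$-plane; it is $T$-axisymmetric if it is invariant under $(U,V)\mapsto(-V,-U)$. Mean curvature is $H=\frac13\operatorname{div} n$ with $n$ the future unit normal. A TSS-CMC hypersurface is a smooth, spacelike, spherically symmetric, $T$-axisymmetric hypersurface with constant mean curvature. For $H\in\mathbb R$ put $k_H(r)=-Hr^3-r^{3/2}(2M-r)^{1/2}$ and $\tilde k_H(r)=-Hr^3+r^{3/2}(2M-r)^{1/2}$ on $(0,2M)$. Let $c_H$ be the minimum of $k_H$, attained at $r_H$, and $C_H$ the maximum of $\tilde k_H$, attained at $R_H$. Write $A=Hr^3+c$ and $D=A^2+r^3(r-2M)$. For $c_H<c<-8M^3H$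 let $R\in(r_H,2M)$ be the solution of $k_H(R)=c$. The hypersurface $\Sigma^+_{H,c}$ consists of the curve, for $r\ge R$, $$V(r)=e^{E(r)/4M},\quad U(r)=(r-2M)\,e^{(2r-E(r))/4M},\quad E(r)=R+2M\ln|R-2M|+\int_R^r\frac{x^4}{D-A\sqrt D}\,dx ,$$ and its image under $(U,V)\mapsto(-V,-U)$. For $c=-8M^3H$ the hypersurface $\Sigma^+_{H,c}$ consists of the curve, for $r\ge 2M$, $$U(r)=\sqrt{r-2M}\,e^{(r-f(r))/4M},\quad V(r)=\sqrt{r-2M}\,e^{(r+f(r))/4M},\quad f(r)=\int_{2M}^r\frac{A}{(1-2M/x)\sqrt D}\,dx,$$ and its image under the same reflection. It passes through the origin and does not meet region II. For $-8M^3H<c<C_H$ let $R\in(R_H,2M)$ be the solution of $\tilde k_H(R)=c$. The hypersurface $\tilde\Sigma^-_{H,c}$ consists of the curve, for $r\ge R$, $$U(r)=e^{\tilde E(r)/4M},\quad V(r)=(r-2M)\,e^{(2r-\tilde E(r))/4M},\quad \tilde E(r)=R+2M\ln|R-2M|+\int_R^r\frac{x^4}{D+A\sqrt D}\,dx ,$$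 and its image under the same reflection. A family $(L_c)_{c\in I}$ of subsets of the $(U,V)$-plane is said to form a foliation of a set $W$ if the $L_c$ are connected (possibly empty) and pairwise disjoint, their union is $W$, and every point of $W$ has an open neighbourhood in $W$ with a homeomorphism onto an open subset of $\mathbb R^2$ under which $L_c$ corresponds, for every $c\in I$, to the set where the second coordinate equals $c$. **Theorem.** There is a constant $C>0$ (depending only on $M$) such that: 1. For every $H\ge -C$, the traces of $\Sigma^+_{H,c}$, $-8M^3H\ge c>c_H$, on region II are TSS-CMC hypersurfaces of mean curvature $H$ (the trace is empty for $c=-8M^3H$), and they form a foliation of the part $\{r_H<r<2M\}$ of region II. 2. For every $H\le C$, the traces of $\tilde\Sigma^-_{H,c}$, $C_H>c>-8M^3H$, on region II' are TSS-CMC hypersurfaces of mean curvature $H$, and they form a foliation of the part $\{R_H<r<2M\}$ of region II'. -/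

import Mathlib

open Set

noncomputable section

namespace Kruskal

/-! # The Kruskal plane

Points of the Kruskal plane are pairs `(U, V)` of null coordinates, `U = X - T`, `V = X + T`.
The area radius `r > 0` is determined by `(r - 2M) e^{r/2M} = U V`, so the Kruskal extension
is the set `U V > -2M` (each point standing for a round sphere), with the metric
`(16 M² e^{-r/2M} / r) dU dV + r² (dθ² + sin²θ dφ²)`; `∂_T` is future directed. -/

/-- The function `r ↦ (r - 2M) e^{r/2M}`, strictly increasing on `(0, ∞)`. -/
def radialProfile (M r : ℝ) : ℝ := (r - 2 * M) * Real.exp (r / (2 * M))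

/-- The area radius: the solution `r > 0` of `(r - 2M) e^{r/2M} = U V`. -/
def areaRadius (M : ℝ) (p : ℝ × ℝ) : ℝ :=
  Function.invFunOn (radialProfile M) (Ioi 0) (p.1 * p.2)

/-- Region II, the interior of the (first) Schwarzschild spacetime:  `U < 0 < V`, `r > 0`. -/
def regionII (M : ℝ) : Set (ℝ × ℝ) := {p | p.1 < 0 ∧ 0 < p.2 ∧ -2 * M < p.1 * p.2}

/-- Region II', the interior of the other Schwarzschild spacetime:  `V < 0 < U`, `r > 0`. -/
def regionII' (M : ℝ) : Set (ℝ × ℝ) := {p | 0 < p.1 ∧ p.2 < 0 ∧ -2 * M < p.1 * p.2}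

theorem radialProfile_strictMonoOn {M : ℝ} (hM : 0 < M) :
    StrictMonoOn (radialProfile M) (Ici 0) := by
  have hd : ∀ r : ℝ, HasDerivAt (radialProfile M)
      (r / (2 * M) * Real.exp (r / (2 * M))) r := by
    intro r
    have h1 : HasDerivAt (fun x : ℝ => x - 2 * M) 1 r := (hasDerivAt_id r).sub_const _
    have h2 : HasDerivAt (fun x : ℝ => Real.exp (x / (2 * M)))
        (Real.exp (r / (2 * M)) * (1 / (2 * M))) r :=
      ((hasDerivAt_id r).div_const (2 * M)).exp
    have h3 := h1.mul h2
    refine h3.congr_deriv ?_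
    field_simp
    ring
  apply strictMonoOn_of_deriv_pos (convex_Ici 0)
  · exact fun x _ => (hd x).continuousAt.continuousWithinAt
  · intro x hx
    rw [interior_Ici] at hx
    rw [(hd x).deriv]
    have : 0 < x := hx
    positivity

theorem areaRadius_spec {M : ℝ} (hM : 0 < M) {p : ℝ × ℝ} (hp : -2 * M < p.1 * p.2) :
    0 < areaRadius M p ∧ radialProfile M (areaRadius M p) = p.1 * p.2 := by
  have hex : ∃ r ∈ Ioi (0 : ℝ), radialProfile M r = p.1 * p.2 := by
    set q := p.1 * p.2 with hq
    have hc : ContinuousOn (radialProfile M) (Icc 0 (2 * M + |q|)) := by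
      unfold radialProfile
      fun_prop
    have h0 : radialProfile M 0 < q := by
      simp only [radialProfile, zero_div, Real.exp_zero]
      linarith
    have h1 : q ≤ radialProfile M (2 * M + |q|) := by
      have he : 1 ≤ Real.exp ((2 * M + |q|) / (2 * M)) :=
        Real.one_le_exp (by positivity)
      have : radialProfile M (2 * M + |q|)
          = |q| * Real.exp ((2 * M + |q|) / (2 * M)) := by
        simp [radialProfile]
      rw [this]
      nlinarith [abs_nonneg q, le_abs_self q]
    obtain ⟨r, hr, hrq⟩ := intermediate_value_Icc (by positivity) hc ⟨h0.le, h1⟩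
    refine ⟨r, lt_of_le_of_ne hr.1 ?_, hrq⟩
    rintro rfl
    exact absurd hrq h0.ne
  exact ⟨Function.invFunOn_mem hex, Function.invFunOn_eq hex⟩

/-! # Spherically symmetric spacelike hypersurfaces of constant mean curvature

A spherically symmetric hypersurface is a curve `(u s, v s)` in the Kruskal plane. It is
spacelike iff `u' v' > 0`; we orient it by `u', v' > 0`. -/

/-- The conformal factor `F(r) = 16 M² e^{-r/2M} / r`, so that the metric is
`F dU dV + r² dσ²`. -/
def confFactor (M r : ℝ) : ℝ := 16 * M ^ 2 * Real.exp (-r / (2 * M)) / r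

/-- The quantity `v' ∂_V r - u' ∂_U r` along the curve `(u, v)`, where
`∂_V r = F U / (8M)` and `∂_U r = F V / (8M)` by differentiating `(r - 2M) e^{r/2M} = U V`. The
future unit normal is `n = (-u' ∂_U + v' ∂_V) / √(F u' v')`, so `n(r)` is this quantity divided by
`√(F u' v')`. -/
def normalRadius (M : ℝ) (u v : ℝ → ℝ) (s : ℝ) : ℝ :=
  confFactor M (areaRadius M (u s, v s)) / (8 * M) * (u s * deriv v s - v s * deriv u s)

/-- The mean curvature `H = (1/3) div n` of the hypersurface swept out by the curve `(u, v)`, `n`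
the future unit normal: `3 H = κ + 2 n(r) / r`, where `κ` is the curvature of the curve in the
Lorentzian metric `F dU dV`,
`κ √(F u' v') = (v''/v' - u''/u') / 2 + (v' ∂_V (log F) - u' ∂_U (log F)) / 2`,
and `d (log F) / dr = -(1/r + 1/(2M))`. -/
def meanCurvature (M : ℝ) (u v : ℝ → ℝ) (s : ℝ) : ℝ :=
  let r := areaRadius M (u s, v s)
  (1 / 3) *
    ((deriv (deriv v) s / deriv v s - deriv (deriv u) s / deriv u s) / 2
        - (1 / r + 1 / (2 * M)) * normalRadius M u v s / 2
        + 2 / r * normalRadius M u v s)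
    / √(confFactor M r * (deriv u s * deriv v s))

/-- `S` is (the curve of) a smooth, embedded, spacelike, spherically symmetric hypersurface of the
Kruskal extension with constant mean curvature `H`. -/
def IsSSCMC (M H : ℝ) (S : Set (ℝ × ℝ)) : Prop :=
  (∀ p ∈ S, -2 * M < p.1 * p.2) ∧
  ∀ p ∈ S, ∃ O : Set (ℝ × ℝ), IsOpen O ∧ p ∈ O ∧
    ∃ (a b : ℝ) (u v : ℝ → ℝ),
      ContDiffOn ℝ (⊤ : ℕ∞) u (Ioo a b) ∧ ContDiffOn ℝ (⊤ : ℕ∞) v (Ioo a b) ∧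
      (∀ s ∈ Ioo a b, 0 < deriv u s ∧ 0 < deriv v s ∧ meanCurvature M u v s = H) ∧
      (fun s => (u s, v s)) '' Ioo a b = S ∩ O

/-- `T`-axisymmetric `SS-CMC` hypersurfaces: symmetric about the `T`-axis `U + V = 0`. -/
def IsTSSCMC (M H : ℝ) (S : Set (ℝ × ℝ)) : Prop :=
  IsSSCMC M H S ∧ ∀ p ∈ S, (-p.2, -p.1) ∈ S

/-! # The functions `k_H` and `k̃_H` on `(0, 2M)` -/

/-- `k_H(r) = -H r³ - r^{3/2} (2M - r)^{1/2}`. -/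
def kFun (M H r : ℝ) : ℝ := -H * r ^ 3 - √(r ^ 3 * (2 * M - r))

/-- `k̃_H(r) = -H r³ + r^{3/2} (2M - r)^{1/2}`. -/
def kTilde (M H r : ℝ) : ℝ := -H * r ^ 3 + √(r ^ 3 * (2 * M - r))

/-- `r_H`: the point of `(0, 2M)` at which `k_H` attains its minimum. -/
def rMin (M H : ℝ) : ℝ :=
  Classical.epsilon fun r => r ∈ Ioo 0 (2 * M) ∧ IsMinOn (kFun M H) (Ioo 0 (2 * M)) r

/-- `c_H`: the minimum value of `k_H` on `(0, 2M)`. -/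
def cMin (M H : ℝ) : ℝ := kFun M H (rMin M H)

/-- `R_H`: the point of `(0, 2M)` at which `k̃_H` attains its maximum. -/
def rMax (M H : ℝ) : ℝ :=
  Classical.epsilon fun r => r ∈ Ioo 0 (2 * M) ∧ IsMaxOn (kTilde M H) (Ioo 0 (2 * M)) r

/-- `C_H`: the maximum value of `k̃_H` on `(0, 2M)`. -/
def cMax (M H : ℝ) : ℝ := kTilde M H (rMax M H)

theorem exists_isMinOn_kFun {M : ℝ} (hM : 0 < M) (H : ℝ) :
    ∃ r, r ∈ Ioo 0 (2 * M) ∧ IsMinOn (kFun M H) (Ioo 0 (2 * M)) r := by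
  have hc : Continuous (kFun M H) := by
    unfold kFun
    fun_prop
  obtain ⟨r, hr, hmin⟩ := (isCompact_Icc (a := (0 : ℝ)) (b := 2 * M)).exists_isMinOn
    ⟨0, by constructor <;> linarith⟩ hc.continuousOn
  have hmin' : ∀ x ∈ Icc 0 (2 * M), kFun M H r ≤ kFun M H x := hmin
  refine ⟨r, ⟨lt_of_le_of_ne hr.1 ?_, lt_of_le_of_ne hr.2 ?_⟩,
    fun x hx => hmin' x (Ioo_subset_Icc_self hx)⟩
  · rintro rfl
    have hq : (0 : ℝ) < 1 + H ^ 2 * M ^ 2 := by positivity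
    set d := M / (1 + H ^ 2 * M ^ 2) with hd
    have hd0 : 0 < d := by positivity
    have hdM : d ≤ M := div_le_self hM.le (by nlinarith [sq_nonneg (H * M)])
    have h := hmin' d ⟨hd0.le, by linarith⟩
    have hlt : -H * d ^ 3 < √(d ^ 3 * (2 * M - d)) := by
      apply Real.lt_sqrt_of_sq_lt
      have h1 : d * (1 + H ^ 2 * M ^ 2) = M := by
        rw [hd]
        field_simp
      have h2 : H ^ 2 * d ^ 3 < M := by
        have : H ^ 2 * d ^ 3 ≤ d * (H ^ 2 * M ^ 2) := by
          have : d ^ 2 ≤ M ^ 2 := by nlinarith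
          nlinarith [mul_nonneg hd0.le (sq_nonneg H)]
        nlinarith
      have : H ^ 2 * d ^ 3 < 2 * M - d := by linarith
      have h3 : 0 < d ^ 3 := by positivity
      nlinarith
    simp only [kFun] at h
    norm_num at h
    linarith
  · rintro rfl
    have hq : (0 : ℝ) < 1 + 144 * H ^ 2 * M ^ 2 := by positivity
    set d := M / (1 + 144 * H ^ 2 * M ^ 2) with hd
    have hd0 : 0 < d := by positivity
    have hdM : d ≤ M := div_le_self hM.le (by nlinarith [sq_nonneg (H * M)])
    have h := hmin' (2 * M - d) ⟨by linarith, by linarith⟩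
    have hlt : H * ((2 * M) ^ 3 - (2 * M - d) ^ 3)
        < √((2 * M - d) ^ 3 * (2 * M - (2 * M - d))) := by
      apply Real.lt_sqrt_of_sq_lt
      have h1 : d * (1 + 144 * H ^ 2 * M ^ 2) = M := by
        rw [hd]
        field_simp
      have e1 : 0 ≤ (2 * M) ^ 3 - (2 * M - d) ^ 3 := by
        have : (2 * M - d) ^ 3 ≤ (2 * M) ^ 3 :=
          pow_le_pow_left₀ (by linarith) (by linarith) 3
        linarith
      have e2 : (2 * M) ^ 3 - (2 * M - d) ^ 3 ≤ 12 * M ^ 2 * d := by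
        nlinarith [sq_nonneg d, mul_nonneg (sq_nonneg d) (by linarith : 0 ≤ 6 * M - d)]
      have e3 : ((2 * M) ^ 3 - (2 * M - d) ^ 3) ^ 2 ≤ (12 * M ^ 2 * d) ^ 2 :=
        pow_le_pow_left₀ e1 e2 2
      have e4 : M ^ 3 ≤ (2 * M - d) ^ 3 := pow_le_pow_left₀ hM.le (by linarith) 3
      have e5 : (144 * H ^ 2 * M ^ 2) * d < M := by nlinarith
      calc (H * ((2 * M) ^ 3 - (2 * M - d) ^ 3)) ^ 2
          = H ^ 2 * ((2 * M) ^ 3 - (2 * M - d) ^ 3) ^ 2 := by ring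
        _ ≤ H ^ 2 * (12 * M ^ 2 * d) ^ 2 := by gcongr
        _ = (M ^ 2 * d) * ((144 * H ^ 2 * M ^ 2) * d) := by ring
        _ < (M ^ 2 * d) * M := by gcongr
        _ = M ^ 3 * d := by ring
        _ ≤ (2 * M - d) ^ 3 * d := by gcongr
        _ = (2 * M - d) ^ 3 * (2 * M - (2 * M - d)) := by ring
    have e0 : √((2 * M) ^ 3 * (2 * M - 2 * M)) = 0 := by simp
    simp only [kFun] at h
    rw [e0] at h
    linarith

theorem exists_isMaxOn_kTilde {M : ℝ} (hM : 0 < M) (H : ℝ) :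
    ∃ r, r ∈ Ioo 0 (2 * M) ∧ IsMaxOn (kTilde M H) (Ioo 0 (2 * M)) r := by
  obtain ⟨r, hr, h⟩ := exists_isMinOn_kFun hM (-H)
  refine ⟨r, hr, fun x hx => ?_⟩
  have h1 : kFun M (-H) r ≤ kFun M (-H) x := h hx
  simp only [kFun] at h1
  simp only [kTilde, mem_ofPred_eq]
  linarith

theorem rMin_spec {M : ℝ} (hM : 0 < M) (H : ℝ) :
    rMin M H ∈ Ioo 0 (2 * M) ∧ IsMinOn (kFun M H) (Ioo 0 (2 * M)) (rMin M H) :=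
  Classical.epsilon_spec (exists_isMinOn_kFun hM H)

theorem rMax_spec {M : ℝ} (hM : 0 < M) (H : ℝ) :
    rMax M H ∈ Ioo 0 (2 * M) ∧ IsMaxOn (kTilde M H) (Ioo 0 (2 * M)) (rMax M H) :=
  Classical.epsilon_spec (exists_isMaxOn_kTilde hM H)

/-- `r⁺_{H,c}`: the solution of `k_H(r) = c` on the increasing part `(r_H, 2M)` of `k_H`. -/
def rPlus (M H c : ℝ) : ℝ := Function.invFunOn (kFun M H) (Ioo (rMin M H) (2 * M)) c

/-- `r̃⁻_{H,c}`: the solution of `k̃_H(r) = c` on the decreasing part `(R_H, 2M)` of `k̃_H`. -/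
def rTildeMinus (M H c : ℝ) : ℝ := Function.invFunOn (kTilde M H) (Ioo (rMax M H) (2 * M)) c

/-! # The families `Σ⁺_{H,c}` and `Σ̃⁻_{H,c}`

With `A = H r³ + c` and `D = A² + r³ (r - 2M)`, a (non-cylindrical) `SS-CMC` hypersurface
`t = f(r)` has `f' = ± A / (h √D)`, `h = 1 - 2M/r`. On the half `U + V ≥ 0` of the `T`-axisymmetric
ones the sign is `+`, and `f = 0` at the initial radius. There
`4M log V = f + r + 2M log |r - 2M|` and `-4M log U = f - r - 2M log |r - 2M|` up to signs of
`U` and `V`, and the two functions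
`f' + 1/h = r⁴ / (D - A √D)`, `-(f' - 1/h) = r⁴ / (D + A √D)`
are the ones that stay regular across `r = 2M` if `A(2M) < 0`, respectively `A(2M) > 0`. -/

/-- `A = H r³ + c`. -/
def aFun (H c r : ℝ) : ℝ := H * r ^ 3 + c

/-- `D = (H r³ + c)² + r³ (r - 2M)`. -/
def dFun (M H c r : ℝ) : ℝ := aFun H c r ^ 2 + r ^ 3 * (r - 2 * M)

/-- `f'(r) = A / (h √D)`. -/
def fDeriv (M H c r : ℝ) : ℝ := aFun H c r / ((1 - 2 * M / r) * √(dFun M H c r))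

/-- `f' + 1/h = r⁴ / (D - A √D)`. -/
def fBar (M H c r : ℝ) : ℝ := r ^ 4 / (dFun M H c r - aFun H c r * √(dFun M H c r))

/-- `1/h - f' = r⁴ / (D + A √D)`. -/
def fBarTilde (M H c r : ℝ) : ℝ := r ^ 4 / (dFun M H c r + aFun H c r * √(dFun M H c r))

/-- Reflection about the `T`-axis. -/
def reflectT (p : ℝ × ℝ) : ℝ × ℝ := (-p.2, -p.1)

/-- The exponent `R + 2M log |R - 2M| + ∫_R^r g`, with `g = f' + 1/h` or `g = 1/h - f'`. -/
def regularExponent (M R : ℝ) (g : ℝ → ℝ) (r : ℝ) : ℝ :=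
  R + 2 * M * Real.log |R - 2 * M| + ∫ x in R..r, g x

/-- The half `U + V ≥ 0` of `Σ⁺_{H,c}` for `c_H < c < -8M³H`, as a curve `r ↦ (U(r), V(r))`,
`r ≥ r⁺_{H,c}`. -/
def plusHalf (M H c r : ℝ) : ℝ × ℝ :=
  ((r - 2 * M) * Real.exp ((2 * r - regularExponent M (rPlus M H c) (fBar M H c) r) / (4 * M)),
    Real.exp (regularExponent M (rPlus M H c) (fBar M H c) r / (4 * M)))

/-- The half `U + V ≥ 0` of `Σ̃⁻_{H,c}` for `-8M³H < c < C_H`, as a curve `r ↦ (U(r), V(r))`,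
`r ≥ r̃⁻_{H,c}`. -/
def tildeMinusHalf (M H c r : ℝ) : ℝ × ℝ :=
  (Real.exp (regularExponent M (rTildeMinus M H c) (fBarTilde M H c) r / (4 * M)),
    (r - 2 * M) *
      Real.exp ((2 * r - regularExponent M (rTildeMinus M H c) (fBarTilde M H c) r) / (4 * M)))

/-- The half `U + V ≥ 0` of the hypersurface with `c = -8M³H`, which passes from region I through
the origin to region I', as a curve `r ↦ (U(r), V(r))`, `r ≥ 2M`. -/
def originHalf (M H r : ℝ) : ℝ × ℝ :=
  (√(r - 2 * M) * Real.exp ((r - ∫ x in (2 * M)..r, fDeriv M H (-8 * M ^ 3 * H) x) / (4 * M)),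
    √(r - 2 * M) * Real.exp ((r + ∫ x in (2 * M)..r, fDeriv M H (-8 * M ^ 3 * H) x) / (4 * M)))

/-- The hypersurface with `c = -8M³H`. -/
def sigmaOrigin (M H : ℝ) : Set (ℝ × ℝ) :=
  originHalf M H '' Ici (2 * M) ∪ reflectT '' (originHalf M H '' Ici (2 * M))

open Classical in
/-- The hypersurface `Σ⁺_{H,c}`, for `c_H < c ≤ -8M³H`, in the Kruskal extension. -/
def sigmaPlus (M H c : ℝ) : Set (ℝ × ℝ) :=
  if c = -8 * M ^ 3 * H then sigmaOrigin M H
  else plusHalf M H c '' Ici (rPlus M H c) ∪ reflectT '' (plusHalf M H c '' Ici (rPlus M H c))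

/-- The hypersurface `Σ̃⁻_{H,c}`, for `-8M³H < c < C_H`, in the Kruskal extension. -/
def sigmaTildeMinus (M H c : ℝ) : Set (ℝ × ℝ) :=
  tildeMinusHalf M H c '' Ici (rTildeMinus M H c) ∪
    reflectT '' (tildeMinusHalf M H c '' Ici (rTildeMinus M H c))

/-! # Foliations -/

/-- The sets `L c`, `c ∈ I`, form a (codimension one) foliation of `W` in the Kruskal plane: they
are connected (the trace on `W` of a member of the family may be empty), pairwise disjoint, they cover `W`, and near every point of `W` there is a foliated
chart, whose transverse coordinate is the parameter `c`. -/
structure IsFoliation (W : Set (ℝ × ℝ)) (I : Set ℝ) (L : ℝ → Set (ℝ × ℝ)) : Prop where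
  connected : ∀ c ∈ I, IsPreconnected (L c)
  disjoint : I.PairwiseDisjoint L
  cover : ⋃ c ∈ I, L c = W
  chart : ∀ p ∈ W, ∃ φ : OpenPartialHomeomorph (ℝ × ℝ) (ℝ × ℝ),
    p ∈ φ.source ∧ φ.source ⊆ W ∧ ∀ c ∈ I, φ.source ∩ L c = {q ∈ φ.source | (φ q).2 = c}

end Kruskal

end

/-! # CMC foliations of the interior of the Kruskal extension

In region II use the area radius `r` and the Schwarzschild time `t = 2M log |V / U|`
(`kruskalII`). The trace of `Σ⁺_{H,c}` is the curve `t = ± f(r)`, where `f` is the integral of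
`A / (h √D)` from the throat radius `R`, and `c = k_H(R)`. Since `k_H` is strictly increasing on
`(r_H, 2M)`, the leaves may be labelled by `R`.

*The leaves are smooth CMC curves.* `D = (r - R) B(r)` with a polynomial `B` that is positive on
`[R, 2M)`. In the parameter `u` with `r = R + u²` the singularity of `1 / √D` disappears, both
halves become one smooth curve (`leafCurve`), and the mean curvature can be computed directly
(`meanCurvature_leafCurve`).

*The leaves do not cross.* This is the claim that at fixed `r` the height `f(r)` is strictly
decreasing in `R` (`height_lt`). Write `P = r^{3/2} (2M - r)^{1/2}`, so that `D = A² - P²`, and let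
`T = √D / (P - A)`, which lies in `[0, 1]` and is strictly decreasing in `R`. For a suitable weight
`μ(r)`, independent of `R`, the derivative of `f - μ T` in `r` is `T (α + β T²)`, where `α` and `β`
depend on `r` and `H` only (`hasDerivAt_height_sub`). For `H ≥ -1 / (6M)` one has `α ≥ 0` and
`α + 3 β ≥ 0` (`psiLin_nonneg`, `psiLin_add_nonneg`), hence this derivative is nondecreasing in `T`.
Since `f` and `T` vanish at the throat, integration shows that `f - μ T` for the smaller of two
throat radii is at least that for the larger one, and `μ T` is strictly larger.

*The leaves fill the region.* At fixed `r` the height tends to infinity as `R → r_H`, because `D`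
has a double root at `r_H` for `c = c_H` (`exists_lt_height_throat`), and at fixed `R` it tends to
infinity as `r → 2M` (`exists_lt_height`). As it is continuous and strictly monotone in each
variable, `(t, c)` is a global coordinate system on the part `r > r_H` of region II (`leafChart`).

Time reversal `(U, V) ↦ (V, U)` exchanges the regions II and II', and `Σ⁺_{H,c}` with
`Σ̃⁻_{-H,-c}`, which gives the statement on region II'. -/

noncomputable section
namespace Kruskal


/-! ### The functions `P`, `k_H` and the sign of `k_H'` -/

/-- `P(x) = x^{3/2} (2M - x)^{1/2}`, so that `k_H = -H x³ - P` and `D = A² - P²`. -/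
def pFun (M x : ℝ) : ℝ := √(x ^ 3 * (2 * M - x))

/-- The factor `2x - 3M - 3 H P` of `k_H' = x² (2x - 3M - 3 H P) / P`. -/
def wFun (M H x : ℝ) : ℝ := 2 * x - 3 * M - 3 * H * pFun M x

theorem kFun_eq (M H x : ℝ) : kFun M H x = -H * x ^ 3 - pFun M x := rfl

theorem pFun_sq {M x : ℝ} (h0 : 0 ≤ x) (h1 : x ≤ 2 * M) :
    pFun M x ^ 2 = x ^ 3 * (2 * M - x) :=
  Real.sq_sqrt (mul_nonneg (by positivity) (by linarith))

theorem pFun_pos {M x : ℝ} (h0 : 0 < x) (h1 : x < 2 * M) : 0 < pFun M x :=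
  Real.sqrt_pos.2 (mul_pos (by positivity) (by linarith))

theorem continuous_pFun (M : ℝ) : Continuous (pFun M) := by
  unfold pFun; fun_prop

theorem continuous_kFun (M H : ℝ) : Continuous (kFun M H) := by
  unfold kFun; fun_prop

theorem pFun_le {M x : ℝ} (h0 : 0 ≤ x) (h1 : x ≤ 2 * M) : pFun M x ≤ 2 * M ^ 2 := by
  have hsq := pFun_sq h0 h1
  have : x ^ 3 * (2 * M - x) ≤ (2 * M ^ 2) ^ 2 := by
    have e1 : x ^ 2 ≤ 4 * M ^ 2 := by nlinarith
    have e2 : x * (2 * M - x) ≤ M ^ 2 := by nlinarith [sq_nonneg (x - M)]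
    have e3 : 0 ≤ x * (2 * M - x) := mul_nonneg h0 (by linarith)
    nlinarith [sq_nonneg M, sq_nonneg x]
  exact abs_le_of_sq_le_sq' (hsq ▸ this) (by positivity) |>.2

theorem hasDerivAt_pFun {M x : ℝ} (h0 : 0 < x) (h1 : x < 2 * M) :
    HasDerivAt (pFun M) (x ^ 2 * (3 * M - 2 * x) / pFun M x) x := by
  have hp : 0 < x ^ 3 * (2 * M - x) := mul_pos (by positivity) (by linarith)
  have h := ((hasDerivAt_pow 3 x).mul ((hasDerivAt_id x).const_sub (2 * M))).sqrt hp.ne'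
  refine h.congr_deriv ?_
  have : √(x ^ 3 * (2 * M - x)) ≠ 0 := (Real.sqrt_pos.2 hp).ne'
  simp only [pFun, Pi.mul_apply, id]
  field_simp
  ring

theorem hasDerivAt_kFun {M H x : ℝ} (h0 : 0 < x) (h1 : x < 2 * M) :
    HasDerivAt (kFun M H) (x ^ 2 * wFun M H x / pFun M x) x := by
  have h := ((hasDerivAt_pow 3 x).const_mul (-H)).sub (hasDerivAt_pFun h0 h1)
  refine h.congr_deriv ?_
  have := (pFun_pos h0 h1).ne'
  simp only [wFun]
  field_simp
  push_cast
  ring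

theorem wFun_rMin {M : ℝ} (hM : 0 < M) (H : ℝ) : wFun M H (rMin M H) = 0 := by
  obtain ⟨hr, hmin⟩ := rMin_spec hM H
  have hloc : IsLocalMin (kFun M H) (rMin M H) := hmin.isLocalMin (Ioo_mem_nhds hr.1 hr.2)
  have h := hloc.hasDerivAt_eq_zero (hasDerivAt_kFun hr.1 hr.2)
  have h1 := (pFun_pos hr.1 hr.2).ne'
  have h2 := hr.1.ne'
  simpa [h1, h2] using h

/-- `w / P = (2x - 3M) / P - 3H`, and `(2x - 3M) / P` is strictly increasing. -/
theorem wFun_pos {M : ℝ} (hM : 0 < M) (H : ℝ) {x : ℝ} (hx : x ∈ Ioo (rMin M H) (2 * M)) :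
    0 < wFun M H x := by
  have hr := (rMin_spec hM H).1
  have hmono : StrictMonoOn (fun x => (2 * x - 3 * M) / pFun M x) (Ioo 0 (2 * M)) := by
    apply strictMonoOn_of_deriv_pos (convex_Ioo 0 (2 * M))
    · exact ContinuousOn.div (by fun_prop) (continuous_pFun M).continuousOn
        fun y hy => (pFun_pos hy.1 hy.2).ne'
    · intro y hy
      rw [interior_Ioo] at hy
      have hP := pFun_pos hy.1 hy.2
      have h := (((hasDerivAt_id y).const_mul 2).sub_const (3 * M)).div
        (hasDerivAt_pFun hy.1 hy.2) hP.ne'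
      have h' : deriv (fun x => (2 * x - 3 * M) / pFun M x) y = _ := h.deriv
      rw [h']
      have e : (2 * 1 * pFun M y - (2 * id y - 3 * M) * (y ^ 2 * (3 * M - 2 * y) / pFun M y)) /
          pFun M y ^ 2 = (2 * pFun M y ^ 2 + (2 * y - 3 * M) ^ 2 * y ^ 2) / pFun M y ^ 3 := by
        simp only [id]
        field_simp
        ring
      rw [e]
      positivity
  have h := hmono hr ⟨hr.1.trans hx.1, hx.2⟩ hx.1
  have h0 := wFun_rMin hM H
  have hP := pFun_pos (hr.1.trans hx.1) hx.2
  have hP0 := pFun_pos hr.1 hr.2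
  have e : (2 * rMin M H - 3 * M) / pFun M (rMin M H) = 3 * H := by
    rw [div_eq_iff hP0.ne']
    unfold wFun at h0
    linarith
  simp only [e] at h
  rw [lt_div_iff₀ hP] at h
  unfold wFun
  linarith

theorem strictMonoOn_kFun {M : ℝ} (hM : 0 < M) (H : ℝ) :
    StrictMonoOn (kFun M H) (Icc (rMin M H) (2 * M)) := by
  have hr := (rMin_spec hM H).1
  apply strictMonoOn_of_deriv_pos (convex_Icc _ _) (continuous_kFun M H).continuousOn
  intro x hx
  rw [interior_Icc] at hx
  have h0 := hr.1.trans hx.1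
  rw [(hasDerivAt_kFun h0 hx.2).deriv]
  have := wFun_pos hM H hx
  have := pFun_pos h0 hx.2
  positivity

theorem kFun_two_mul (M H : ℝ) : kFun M H (2 * M) = -8 * M ^ 3 * H := by
  simp [kFun]
  ring

theorem kFun_mem_Ioo {M : ℝ} (hM : 0 < M) {H R : ℝ} (hR : R ∈ Ioo (rMin M H) (2 * M)) :
    kFun M H R ∈ Ioo (cMin M H) (-8 * M ^ 3 * H) := by
  have hr := (rMin_spec hM H).1
  rw [← kFun_two_mul]
  exact ⟨strictMonoOn_kFun hM H ⟨le_rfl, hr.2.le⟩ (Ioo_subset_Icc_self hR) hR.1,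
    strictMonoOn_kFun hM H (Ioo_subset_Icc_self hR) ⟨hr.2.le, le_rfl⟩ hR.2⟩

theorem rPlus_spec {M : ℝ} (hM : 0 < M) {H c : ℝ} (hc : c ∈ Ioo (cMin M H) (-8 * M ^ 3 * H)) :
    rPlus M H c ∈ Ioo (rMin M H) (2 * M) ∧ kFun M H (rPlus M H c) = c := by
  have hr := (rMin_spec hM H).1
  have hex : ∃ x ∈ Ioo (rMin M H) (2 * M), kFun M H x = c :=
    intermediate_value_Ioo hr.2.le (continuous_kFun M H).continuousOn
      (by rw [kFun_two_mul]; exact hc)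
  exact ⟨Function.invFunOn_mem hex, Function.invFunOn_eq hex⟩

/-! ### `A` and `D` along the leaf with throat radius `R` -/

section
variable {M H R x : ℝ}

theorem aFun_kFun_le (hM : 0 < M) (hR : R ∈ Ioo (rMin M H) (2 * M)) (hx : x ∈ Ico R (2 * M)) :
    aFun H (kFun M H R) x ≤ -pFun M x := by
  have h := (strictMonoOn_kFun hM H).monotoneOn (Ioo_subset_Icc_self hR)
    ⟨hR.1.le.trans hx.1, hx.2.le⟩ hx.1
  rw [kFun_eq M H x] at h
  unfold aFun
  linarith

theorem aFun_kFun_lt (hM : 0 < M) (hR : R ∈ Ioo (rMin M H) (2 * M)) (hx : x ∈ Ioo R (2 * M)) :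
    aFun H (kFun M H R) x < -pFun M x := by
  have h := (strictMonoOn_kFun hM H) (Ioo_subset_Icc_self hR)
    ⟨hR.1.le.trans hx.1.le, hx.2.le⟩ hx.1
  rw [kFun_eq M H x] at h
  unfold aFun
  linarith

theorem dFun_eq (c : ℝ) (h0 : 0 ≤ x) (h1 : x ≤ 2 * M) :
    dFun M H c x = aFun H c x ^ 2 - pFun M x ^ 2 := by
  rw [pFun_sq h0 h1, dFun]
  ring

theorem pos_of_mem (hM : 0 < M) (hR : R ∈ Ioo (rMin M H) (2 * M)) : 0 < R :=
  (rMin_spec hM H).1.1.trans hR.1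

theorem dFun_pos (hM : 0 < M) (hR : R ∈ Ioo (rMin M H) (2 * M)) (hx : x ∈ Ioo R (2 * M)) :
    0 < dFun M H (kFun M H R) x := by
  have h0 := (pos_of_mem hM hR).trans hx.1
  rw [dFun_eq _ h0.le hx.2.le]
  have := pFun_pos h0 hx.2
  nlinarith [aFun_kFun_lt hM hR hx]

theorem dFun_self (hM : 0 < M) (hR : R ∈ Ioo (rMin M H) (2 * M)) :
    dFun M H (kFun M H R) R = 0 := by
  rw [dFun_eq _ (pos_of_mem hM hR).le hR.2.le, aFun, kFun_eq]
  ring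

/-- The divided difference `(D(x) - D(R)) / (x - R)`, a polynomial in `x`. -/
def bFun (M H c R x : ℝ) : ℝ :=
  H ^ 2 * (x ^ 5 + x ^ 4 * R + x ^ 3 * R ^ 2 + x ^ 2 * R ^ 3 + x * R ^ 4 + R ^ 5)
    + (2 * H * c - 2 * M) * (x ^ 2 + x * R + R ^ 2)
    + (x ^ 3 + x ^ 2 * R + x * R ^ 2 + R ^ 3)

theorem dFun_eq_add (c : ℝ) : dFun M H c x = dFun M H c R + (x - R) * bFun M H c R x := by
  simp only [dFun, aFun, bFun]
  ring

theorem bFun_self :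
    bFun M H (kFun M H R) R R = 2 * R ^ 2 * wFun M H R := by
  simp only [bFun, kFun_eq, wFun]
  ring

theorem dFun_eq_mul (hM : 0 < M) (hR : R ∈ Ioo (rMin M H) (2 * M)) :
    dFun M H (kFun M H R) x = (x - R) * bFun M H (kFun M H R) R x := by
  rw [dFun_eq_add (R := R), dFun_self hM hR, zero_add]

theorem bFun_pos (hM : 0 < M) (hR : R ∈ Ioo (rMin M H) (2 * M)) (hx : x ∈ Ico R (2 * M)) :
    0 < bFun M H (kFun M H R) R x := by
  rcases hx.1.eq_or_lt with rfl | hlt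
  · rw [bFun_self]
    have := wFun_pos hM H hR
    have := pos_of_mem hM hR
    positivity
  · have h := dFun_pos hM hR ⟨hlt, hx.2⟩
    rw [dFun_eq_mul hM hR] at h
    exact (mul_pos_iff_of_pos_left (sub_pos.2 hlt)).1 h

end


/-! ### The height function of a leaf -/

/-- The derivative `dt/du` of the Schwarzschild time along the leaf with throat radius `R`, in the
parameter `u` with `r = R + u²`. It is regular at the throat `u = 0`. -/
def heightDensity (M H R u : ℝ) : ℝ :=
  2 * (R + u ^ 2) * (-aFun H (kFun M H R) (R + u ^ 2)) /
    ((2 * M - (R + u ^ 2)) * √(bFun M H (kFun M H R) R (R + u ^ 2)))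

/-- The Schwarzschild time along the leaf with throat radius `R`, as a function of `u` with
`r = R + u²`. -/
def heightParam (M H R u : ℝ) : ℝ := ∫ w in (0 : ℝ)..u, heightDensity M H R w

/-- The Schwarzschild time along the leaf with throat radius `R`, as a function of `r`; this is the
integral `f` of `A / (h √D)` from `R` to `r`. -/
def height (M H R r : ℝ) : ℝ := heightParam M H R (√(r - R))

/-- The parameters `u` with `R + u² < 2M`. -/
def throatInterval (M R : ℝ) : Set ℝ := Ioo (-√(2 * M - R)) (√(2 * M - R))

section
variable {M H R x u : ℝ}

theorem mem_throatInterval : u ∈ throatInterval M R ↔ R + u ^ 2 < 2 * M := by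
  rw [throatInterval, mem_Ioo, ← abs_lt, Real.lt_sqrt (abs_nonneg u), sq_abs]
  constructor <;> intro h <;> linarith

theorem mem_Ico_of_mem_throatInterval (hu : u ∈ throatInterval M R) :
    R + u ^ 2 ∈ Ico R (2 * M) :=
  ⟨by linarith [sq_nonneg u], mem_throatInterval.1 hu⟩

theorem zero_mem_throatInterval (hR : R < 2 * M) : 0 ∈ throatInterval M R := by
  rw [mem_throatInterval]
  simpa using hR

theorem sqrt_mem_throatInterval (hx : x ∈ Ico R (2 * M)) : √(x - R) ∈ throatInterval M R := by
  rw [mem_throatInterval, Real.sq_sqrt (by linarith [hx.1])]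
  linarith [hx.2]

theorem contDiffOn_heightDensity (hM : 0 < M) (hR : R ∈ Ioo (rMin M H) (2 * M)) :
    ContDiffOn ℝ (⊤ : ℕ∞) (heightDensity M H R) (throatInterval M R) := by
  unfold heightDensity
  apply ContDiffOn.div
  · simp only [aFun]
    fun_prop
  · apply ContDiffOn.mul (by fun_prop)
    apply ContDiffOn.sqrt
    · simp only [bFun]
      fun_prop
    · intro v hv
      exact (bFun_pos hM hR (mem_Ico_of_mem_throatInterval hv)).ne'
  · intro v hv
    have h := mem_Ico_of_mem_throatInterval hv
    exact (mul_pos (by linarith [h.2]) (Real.sqrt_pos.2 (bFun_pos hM hR h))).ne'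

theorem hasDerivAt_heightParam (hM : 0 < M) (hR : R ∈ Ioo (rMin M H) (2 * M))
    (hu : u ∈ throatInterval M R) :
    HasDerivAt (heightParam M H R) (heightDensity M H R u) u := by
  have hc := (contDiffOn_heightDensity hM hR).continuousOn
  have hnhds : throatInterval M R ∈ nhds u := isOpen_Ioo.mem_nhds hu
  apply intervalIntegral.integral_hasDerivAt_right
  · apply ContinuousOn.intervalIntegrable
    exact hc.mono ((ordConnected_Ioo).uIcc_subset (zero_mem_throatInterval hR.2) hu)
  · exact hc.stronglyMeasurableAtFilter isOpen_Ioo u hu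
  · exact hc.continuousAt hnhds

theorem contDiffOn_heightParam (hM : 0 < M) (hR : R ∈ Ioo (rMin M H) (2 * M)) :
    ContDiffOn ℝ (⊤ : ℕ∞) (heightParam M H R) (throatInterval M R) := by
  refine (contDiffOn_infty_iff_deriv_of_isOpen isOpen_Ioo).2 ⟨fun u hu =>
    (hasDerivAt_heightParam hM hR hu).differentiableAt.differentiableWithinAt,
    (contDiffOn_heightDensity hM hR).congr fun u hu => (hasDerivAt_heightParam hM hR hu).deriv⟩

theorem heightParam_neg : heightParam M H R (-u) = -heightParam M H R u := by
  have h := intervalIntegral.integral_comp_neg (a := 0) (b := u) (heightDensity M H R)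
  have e : ∀ w, heightDensity M H R (-w) = heightDensity M H R w := by
    intro w
    simp [heightDensity]
  simp only [e, neg_zero] at h
  rw [heightParam, heightParam, h, intervalIntegral.integral_symm]

theorem height_self : height M H R R = 0 := by
  simp [height, heightParam]

theorem continuousOn_height (hM : 0 < M) (hR : R ∈ Ioo (rMin M H) (2 * M)) :
    ContinuousOn (height M H R) (Ico R (2 * M)) :=
  (contDiffOn_heightParam hM hR).continuousOn.comp (by fun_prop)
    fun _ hx => sqrt_mem_throatInterval hx

theorem sqrt_dFun (hM : 0 < M) (hR : R ∈ Ioo (rMin M H) (2 * M)) (hx : R ≤ x) :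
    √(dFun M H (kFun M H R) x) = √(x - R) * √(bFun M H (kFun M H R) R x) := by
  rw [dFun_eq_mul hM hR, Real.sqrt_mul (by linarith)]

theorem hasDerivAt_height (hM : 0 < M) (hR : R ∈ Ioo (rMin M H) (2 * M))
    (hx : x ∈ Ioo R (2 * M)) :
    HasDerivAt (height M H R)
      (x * -aFun H (kFun M H R) x / ((2 * M - x) * √(dFun M H (kFun M H R) x))) x := by
  have hx' : x ∈ Ico R (2 * M) := Ioo_subset_Ico_self hx
  have h0 : 0 < x - R := sub_pos.2 hx.1
  have hs := Real.sqrt_pos.2 h0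
  have h1 := hasDerivAt_heightParam hM hR (sqrt_mem_throatInterval hx')
  have h2 : HasDerivAt (fun y : ℝ => √(y - R)) (1 / (2 * √(x - R))) x :=
    ((hasDerivAt_id x).sub_const R).sqrt h0.ne'
  refine (h1.comp x h2).congr_deriv ?_
  have hB := Real.sqrt_pos.2 (bFun_pos hM hR hx')
  have hy : 2 * M - x ≠ 0 := by linarith [hx.2]
  rw [sqrt_dFun hM hR hx.1.le, heightDensity, Real.sq_sqrt h0.le, add_sub_cancel]
  field_simp

theorem strictMonoOn_height (hM : 0 < M) (hR : R ∈ Ioo (rMin M H) (2 * M)) :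
    StrictMonoOn (height M H R) (Ico R (2 * M)) := by
  apply strictMonoOn_of_deriv_pos (convex_Ico _ _) (continuousOn_height hM hR)
  intro x hx
  rw [interior_Ico] at hx
  rw [(hasDerivAt_height hM hR hx).deriv]
  have h0 := (pos_of_mem hM hR).trans hx.1
  have h1 := aFun_kFun_lt hM hR hx
  have h2 := pFun_pos h0 hx.2
  have h3 := Real.sqrt_pos.2 (dFun_pos hM hR hx)
  have h4 : 0 < -aFun H (kFun M H R) x := by linarith
  have h5 : 0 < 2 * M - x := by linarith [hx.2]
  positivity

theorem height_nonneg (hM : 0 < M) (hR : R ∈ Ioo (rMin M H) (2 * M)) (hx : x ∈ Ico R (2 * M)) :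
    0 ≤ height M H R x := by
  have h := (strictMonoOn_height hM hR).monotoneOn ⟨le_rfl, hR.2⟩ hx hx.1
  rwa [height_self] at h

/-! ### The height is strictly decreasing in the throat radius -/

/-- The hyperbolic tangent of half the boost angle `θ`, where `A = -P cosh θ`, `√D = P sinh θ`. -/
def halfBoost (M H c x : ℝ) : ℝ := √(dFun M H c x) / (pFun M x - aFun H c x)

/-- The multiple of `halfBoost` which is compared with the height. It is chosen so that the
derivatives of both have the same singularity at the throat. -/
def boostWeight (M H x : ℝ) : ℝ := 2 * x ^ 2 / wFun M H x

/-- The coefficient of `T` in the derivative of `height - boostWeight * T`, with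
`T = halfBoost`. -/
def psiLin (M H x : ℝ) : ℝ :=
  -((4 * x * wFun M H x
      - 2 * x ^ 2 * (2 - 3 * H * (x ^ 2 * (3 * M - 2 * x) / pFun M x))) / wFun M H x ^ 2)
    + boostWeight M H x / (8 * (x * (2 * M - x))) * (4 * x - 6 * M - 18 * H * pFun M x)

/-- The coefficient of `T³` in the derivative of `height - boostWeight * T`, with
`T = halfBoost`. -/
def psiCub (M H x : ℝ) : ℝ :=
  boostWeight M H x / (8 * (x * (2 * M - x))) * (4 * x - 6 * M + 6 * H * pFun M x)

theorem hasDerivAt_boostWeight (h0 : 0 < x) (h1 : x < 2 * M) (hw : 0 < wFun M H x) :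
    HasDerivAt (boostWeight M H)
      ((4 * x * wFun M H x
        - 2 * x ^ 2 * (2 - 3 * H * (x ^ 2 * (3 * M - 2 * x) / pFun M x))) / wFun M H x ^ 2) x := by
  have h := ((hasDerivAt_pow 2 x).const_mul 2).div
    ((((hasDerivAt_id x).const_mul 2).sub_const (3 * M)).sub
      ((hasDerivAt_pFun h0 h1).const_mul (3 * H))) hw.ne'
  refine h.congr_deriv ?_
  simp only [wFun, Pi.sub_apply, id]
  push_cast
  ring

theorem hasDerivAt_aFun (H c x : ℝ) : HasDerivAt (aFun H c) (3 * H * x ^ 2) x := by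
  refine (((hasDerivAt_pow 3 x).const_mul H).add_const c).congr_deriv ?_
  push_cast
  ring

/-- The derivative of `T = S / (P - A)`, `S² = A² - P²`, is `(A P' - P A') / (S (P - A))`. -/
theorem hasDerivAt_halfBoost (hM : 0 < M) (hR : R ∈ Ioo (rMin M H) (2 * M))
    (hx : x ∈ Ioo R (2 * M)) :
    HasDerivAt (halfBoost M H (kFun M H R))
      ((aFun H (kFun M H R) x * (x ^ 2 * (3 * M - 2 * x) / pFun M x)
          - pFun M x * (3 * H * x ^ 2)) /
        (√(dFun M H (kFun M H R) x) * (pFun M x - aFun H (kFun M H R) x))) x := by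
  have h0 := (pos_of_mem hM hR).trans hx.1
  have hP := pFun_pos h0 hx.2
  have hA := aFun_kFun_lt hM hR hx
  have hD := dFun_pos hM hR hx
  have hS := Real.sqrt_pos.2 hD
  have hS2 := Real.sq_sqrt hD.le
  have hDA := dFun_eq (H := H) (kFun M H R) h0.le hx.2.le
  have hP2 := pFun_sq h0.le hx.2.le
  have hdD : HasDerivAt (dFun M H (kFun M H R))
      (2 * aFun H (kFun M H R) x * (3 * H * x ^ 2) + (4 * x ^ 3 - 6 * M * x ^ 2)) x := by
    have h := ((hasDerivAt_aFun H (kFun M H R) x).pow 2).add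
      ((hasDerivAt_pow 3 x).mul ((hasDerivAt_id x).sub_const (2 * M)))
    refine h.congr_deriv ?_
    simp only [id]
    push_cast
    ring
  have h := (hdD.sqrt hD.ne').div ((hasDerivAt_pFun h0 hx.2).sub
    (hasDerivAt_aFun H (kFun M H R) x)) (by simp only [Pi.sub_apply]; linarith)
  refine h.congr_deriv ?_
  have hne : pFun M x - aFun H (kFun M H R) x ≠ 0 := by linarith
  simp only [Pi.sub_apply]
  set A := aFun H (kFun M H R) x
  set P := pFun M x
  set S := √(dFun M H (kFun M H R) x)
  rw [hDA] at hS2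
  field_simp
  rw [hS2]
  have hP3 : P ^ 2 = x ^ 3 * (2 * M - x) := hP2
  ring

theorem halfBoost_sq (hM : 0 < M) (hR : R ∈ Ioo (rMin M H) (2 * M)) (hx : x ∈ Ioo R (2 * M)) :
    halfBoost M H (kFun M H R) x ^ 2 =
      (-aFun H (kFun M H R) x - pFun M x) / (pFun M x - aFun H (kFun M H R) x) := by
  have h0 := (pos_of_mem hM hR).trans hx.1
  have hP := pFun_pos h0 hx.2
  have hA := aFun_kFun_lt hM hR hx
  have hne : pFun M x - aFun H (kFun M H R) x ≠ 0 := by linarith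
  rw [halfBoost, div_pow, Real.sq_sqrt (dFun_pos hM hR hx).le, dFun_eq _ h0.le hx.2.le]
  field_simp
  ring

/-- The derivative of `P`, rewritten with `P² = x³ (2M - x)` so that `P` is not in a denominator. -/
theorem deriv_pFun_eq (h0 : 0 < x) (h1 : x < 2 * M) :
    x ^ 2 * (3 * M - 2 * x) / pFun M x = pFun M x * (3 * M - 2 * x) / (x * (2 * M - x)) := by
  have hy : 0 < 2 * M - x := by linarith
  rw [div_eq_div_iff (pFun_pos h0 h1).ne' (by positivity)]
  linear_combination (-(3 * M - 2 * x)) * pFun_sq h0.le h1.le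

/-- The identity behind the monotonicity: the leaf enters the derivative of
`height - boostWeight * halfBoost` only through the value of `halfBoost`. -/
theorem hasDerivAt_height_sub (hM : 0 < M) (hR : R ∈ Ioo (rMin M H) (2 * M))
    (hx : x ∈ Ioo R (2 * M)) :
    HasDerivAt (fun y => height M H R y - boostWeight M H y * halfBoost M H (kFun M H R) y)
      (halfBoost M H (kFun M H R) x *
        (psiLin M H x + psiCub M H x * halfBoost M H (kFun M H R) x ^ 2)) x := by
  have h0 := (pos_of_mem hM hR).trans hx.1
  have hw := wFun_pos hM H ⟨hR.1.trans hx.1, hx.2⟩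
  have h := (hasDerivAt_height hM hR hx).sub
    ((hasDerivAt_boostWeight h0 hx.2 hw).mul (hasDerivAt_halfBoost hM hR hx))
  refine h.congr_deriv ?_
  have hP := pFun_pos h0 hx.2
  have hA := aFun_kFun_lt hM hR hx
  have hne : pFun M x - aFun H (kFun M H R) x ≠ 0 := by linarith
  have hD := dFun_pos hM hR hx
  have hS := Real.sqrt_pos.2 hD
  have hS2 := (Real.sq_sqrt hD.le).trans (dFun_eq (H := H) (kFun M H R) h0.le hx.2.le)
  have hP2 := pFun_sq h0.le hx.2.le
  have hy : 0 < 2 * M - x := by linarith [hx.2]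
  rw [halfBoost_sq hM hR hx]
  unfold psiLin psiCub boostWeight halfBoost
  have hwdef : wFun M H x = 2 * x - 3 * M - 3 * H * pFun M x := rfl
  set A := aFun H (kFun M H R) x
  set P := pFun M x
  set S := √(dFun M H (kFun M H R) x)
  set W := wFun M H x
  set Q := 4 * x * W - 2 * x ^ 2 * (2 - 3 * H * (x ^ 2 * (3 * M - 2 * x) / P))
  have e1 : x ^ 2 * (3 * M - 2 * x) / P = P * (3 * M - 2 * x) / (x * (2 * M - x)) :=
    deriv_pFun_eq h0 hx.2
  rw [e1]
  have key : x * -A / ((2 * M - x) * S) -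
      2 * x ^ 2 / W * ((A * (P * (3 * M - 2 * x) / (x * (2 * M - x))) - P * (3 * H * x ^ 2)) /
        (S * (P - A))) = S / (P - A) * (2 * x ^ 2 / W / (8 * (x * (2 * M - x))) *
          ((4 * x - 6 * M - 18 * H * P) + (4 * x - 6 * M + 6 * H * P) *
            ((-A - P) / (P - A)))) := by
    field_simp
    rw [hS2, hwdef]
    have hP3 : P ^ 3 = P * (x ^ 3 * (2 * M - x)) := by rw [← hP2]; ring
    linear_combination (-(48 * H * (P - A))) * hP3
  linear_combination key

/-- The only place where `H ≥ -1 / (6M)` enters; it makes the term `12M - 4x + 12 H P` below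
nonnegative. -/
theorem six_mul_pFun_ge (hM : 0 < M) (hH : -(1 / (6 * M)) ≤ H) (h0 : 0 ≤ x) (h1 : x < 2 * M) :
    -(2 * M) ≤ 6 * H * pFun M x := by
  have h2 : -(1 / (6 * M)) * pFun M x ≤ H * pFun M x :=
    mul_le_mul_of_nonneg_right hH (Real.sqrt_nonneg _)
  have h3 : 1 / (6 * M) * pFun M x ≤ 1 / (6 * M) * (2 * M ^ 2) :=
    mul_le_mul_of_nonneg_left (pFun_le h0 h1.le) (by positivity)
  have h4 : 1 / (6 * M) * (2 * M ^ 2) = M / 3 := by field_simp; norm_num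
  linarith

theorem psiLin_nonneg (hM : 0 < M) (hH : -(1 / (6 * M)) ≤ H)
    (hx : x ∈ Ioo (rMin M H) (2 * M)) : 0 ≤ psiLin M H x := by
  have h0 := (rMin_spec hM H).1.1.trans hx.1
  have hw := wFun_pos hM H hx
  have hP := pFun_pos h0 hx.2
  have hP2 := pFun_sq h0.le hx.2.le
  have hy : 0 < 2 * M - x := by linarith [hx.2]
  have hHP := six_mul_pFun_ge hM hH h0.le hx.2
  have e : psiLin M H x = 2 * x ^ 2 / (2 * wFun M H x ^ 2) *
      ((12 * M - 4 * x + 2 * (6 * H * pFun M x)) / x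
        + ((4 * x - 6 * M) ^ 2 + 3 * (6 * H * pFun M x) ^ 2) / (8 * (x * (2 * M - x)))) := by
    have e1 := deriv_pFun_eq h0 hx.2
    rw [psiLin, e1, boostWeight]
    have hwdef : wFun M H x = 2 * x - 3 * M - 3 * H * pFun M x := rfl
    field_simp
    rw [hwdef]
    ring
  rw [e]
  have : 0 ≤ 12 * M - 4 * x + 2 * (6 * H * pFun M x) := by linarith
  positivity

theorem psiLin_add_nonneg (hM : 0 < M) (hH : -(1 / (6 * M)) ≤ H)
    (hx : x ∈ Ioo (rMin M H) (2 * M)) : 0 ≤ psiLin M H x + 3 * psiCub M H x := by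
  have h0 := (rMin_spec hM H).1.1.trans hx.1
  have hw := wFun_pos hM H hx
  have hP := pFun_pos h0 hx.2
  have hP2 := pFun_sq h0.le hx.2.le
  have hy : 0 < 2 * M - x := by linarith [hx.2]
  have e : psiLin M H x + 3 * psiCub M H x = 2 * x ^ 2 / (2 * wFun M H x ^ 2) *
      ((12 * M - 4 * x + 2 * (6 * H * pFun M x)) / x
        + (4 * x - 6 * M) ^ 2 / (2 * (x * (2 * M - x)))) := by
    have e1 := deriv_pFun_eq h0 hx.2
    rw [psiLin, psiCub, e1, boostWeight]
    have hwdef : wFun M H x = 2 * x - 3 * M - 3 * H * pFun M x := rfl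
    field_simp
    rw [hwdef]
    ring
  rw [e]
  have := six_mul_pFun_ge hM hH h0.le hx.2
  have : 0 ≤ 12 * M - 4 * x + 2 * (6 * H * pFun M x) := by linarith [hx.2]
  positivity

theorem continuousOn_halfBoost (hM : 0 < M) (hR : R ∈ Ioo (rMin M H) (2 * M)) :
    ContinuousOn (halfBoost M H (kFun M H R)) (Ico R (2 * M)) := by
  apply ContinuousOn.div
  · apply Continuous.continuousOn
    unfold dFun aFun
    fun_prop
  · apply Continuous.continuousOn
    unfold pFun aFun
    fun_prop
  · intro x hx
    have h0 := (pos_of_mem hM hR).trans_le hx.1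
    linarith [pFun_pos h0 hx.2, aFun_kFun_le hM hR hx]

theorem continuousOn_boostWeight (hM : 0 < M) (H : ℝ) :
    ContinuousOn (boostWeight M H) (Ioo (rMin M H) (2 * M)) := by
  intro x hx
  exact (hasDerivAt_boostWeight ((rMin_spec hM H).1.1.trans hx.1) hx.2
    (wFun_pos hM H hx)).continuousAt.continuousWithinAt

theorem halfBoost_self (hM : 0 < M) (hR : R ∈ Ioo (rMin M H) (2 * M)) :
    halfBoost M H (kFun M H R) R = 0 := by
  simp [halfBoost, dFun_self hM hR]

theorem halfBoost_nonneg (hM : 0 < M) (hR : R ∈ Ioo (rMin M H) (2 * M))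
    (hx : x ∈ Ico R (2 * M)) : 0 ≤ halfBoost M H (kFun M H R) x := by
  have h0 := (pos_of_mem hM hR).trans_le hx.1
  exact div_nonneg (Real.sqrt_nonneg _) (by linarith [pFun_pos h0 hx.2, aFun_kFun_le hM hR hx])

theorem halfBoost_le_one (hM : 0 < M) (hR : R ∈ Ioo (rMin M H) (2 * M))
    (hx : x ∈ Ioo R (2 * M)) : halfBoost M H (kFun M H R) x ≤ 1 := by
  have h0 := (pos_of_mem hM hR).trans hx.1
  have hP := pFun_pos h0 hx.2
  have h1 := aFun_kFun_lt hM hR hx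
  rw [← sq_le_one_iff₀ (halfBoost_nonneg hM hR (Ioo_subset_Ico_self hx)), halfBoost_sq hM hR hx,
    div_le_one (by linarith)]
  linarith

theorem halfBoost_lt {R' : ℝ} (hM : 0 < M) (hR : R ∈ Ioo (rMin M H) (2 * M))
    (hR' : R' ∈ Ioo (rMin M H) (2 * M)) (hlt : R < R') (hx : x ∈ Ico R' (2 * M)) :
    halfBoost M H (kFun M H R') x < halfBoost M H (kFun M H R) x := by
  have h0 := (pos_of_mem hM hR').trans_le hx.1
  have hP := pFun_pos h0 hx.2
  have hxR : x ∈ Ioo R (2 * M) := ⟨hlt.trans_le hx.1, hx.2⟩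
  have hk := strictMonoOn_kFun hM H (Ioo_subset_Icc_self hR) (Ioo_subset_Icc_self hR') hlt
  have hA' := aFun_kFun_le hM hR' hx
  have hA : aFun H (kFun M H R) x < aFun H (kFun M H R') x := by unfold aFun; linarith
  have hnn := halfBoost_nonneg hM hR (Ioo_subset_Ico_self hxR)
  rcases hx.1.eq_or_lt with rfl | hlt'
  · rw [halfBoost_self hM hR']
    exact div_pos (Real.sqrt_pos.2 (dFun_pos hM hR hxR)) (by linarith)
  · rw [← sq_lt_sq₀ (halfBoost_nonneg hM hR' hx) hnn, halfBoost_sq hM hR hxR,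
      halfBoost_sq hM hR' ⟨hlt', hx.2⟩, div_lt_div_iff₀ (by linarith) (by linarith)]
    nlinarith

/-- `T ↦ T (α + β T²)` is nondecreasing on `[0, 1]`, because its derivative `α + 3 β T²` is
nonnegative at both ends. -/
theorem psi_mono {α β S T : ℝ} (hα : 0 ≤ α) (hβ : 0 ≤ α + 3 * β) (hS : 0 ≤ S) (hST : S ≤ T)
    (hT : T ≤ 1) : S * (α + β * S ^ 2) ≤ T * (α + β * T ^ 2) := by
  have hm0 : 0 ≤ T ^ 2 + T * S + S ^ 2 := by nlinarith
  have hm3 : T ^ 2 + T * S + S ^ 2 ≤ 3 := by nlinarith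
  have : 0 ≤ α + β * (T ^ 2 + T * S + S ^ 2) := by nlinarith
  nlinarith [mul_nonneg (sub_nonneg.2 hST) this]

theorem continuousOn_height_sub (hM : 0 < M) (hR : R ∈ Ioo (rMin M H) (2 * M)) :
    ContinuousOn (fun y => height M H R y - boostWeight M H y * halfBoost M H (kFun M H R) y)
      (Ico R (2 * M)) :=
  (continuousOn_height hM hR).sub (((continuousOn_boostWeight hM H).mono
    fun _ hy => ⟨hR.1.trans_le hy.1, hy.2⟩).mul (continuousOn_halfBoost hM hR))

theorem boostWeight_mul_halfBoost_le (hM : 0 < M) (hH : -(1 / (6 * M)) ≤ H)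
    (hR : R ∈ Ioo (rMin M H) (2 * M)) (hx : x ∈ Ico R (2 * M)) :
    boostWeight M H x * halfBoost M H (kFun M H R) x ≤ height M H R x := by
  have hmono : MonotoneOn
      (fun y => height M H R y - boostWeight M H y * halfBoost M H (kFun M H R) y)
      (Ico R (2 * M)) := by
    apply monotoneOn_of_deriv_nonneg (convex_Ico _ _) (continuousOn_height_sub hM hR)
    · intro y hy
      rw [interior_Ico] at hy
      exact (hasDerivAt_height_sub hM hR hy).differentiableAt.differentiableWithinAt
    · intro y hy
      rw [interior_Ico] at hy
      have hy' : y ∈ Ioo (rMin M H) (2 * M) := ⟨hR.1.trans hy.1, hy.2⟩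
      rw [(hasDerivAt_height_sub hM hR hy).deriv]
      have h := psi_mono (psiLin_nonneg hM hH hy') (psiLin_add_nonneg hM hH hy') le_rfl
        (halfBoost_nonneg hM hR (Ioo_subset_Ico_self hy)) (halfBoost_le_one hM hR hy)
      rwa [zero_mul] at h
  have h := hmono ⟨le_rfl, hR.2⟩ hx hx.1
  simp only [height_self, halfBoost_self hM hR] at h
  linarith

/-- At a fixed area radius the height is strictly decreasing in the throat radius. Both
`height - boostWeight * halfBoost` and its growth in `r` are at least as large for the leaf with the
smaller throat. -/
theorem height_lt {R' : ℝ} (hM : 0 < M) (hH : -(1 / (6 * M)) ≤ H)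
    (hR : R ∈ Ioo (rMin M H) (2 * M)) (hR' : R' ∈ Ioo (rMin M H) (2 * M)) (hlt : R < R')
    (hx : x ∈ Ico R' (2 * M)) : height M H R' x < height M H R x := by
  have hsub : Ico R' (2 * M) ⊆ Ico R (2 * M) := Ico_subset_Ico_left hlt.le
  have hmono : MonotoneOn
      (fun y => (height M H R y - boostWeight M H y * halfBoost M H (kFun M H R) y) -
        (height M H R' y - boostWeight M H y * halfBoost M H (kFun M H R') y))
      (Ico R' (2 * M)) := by
    have hd : ∀ y ∈ Ioo R' (2 * M), _ := fun y hy =>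
      (hasDerivAt_height_sub hM hR ⟨hlt.trans hy.1, hy.2⟩).sub (hasDerivAt_height_sub hM hR' hy)
    apply monotoneOn_of_deriv_nonneg (convex_Ico _ _)
      (((continuousOn_height_sub hM hR).mono hsub).sub (continuousOn_height_sub hM hR'))
    · intro y hy
      rw [interior_Ico] at hy
      exact (hd y hy).differentiableAt.differentiableWithinAt
    · intro y hy
      rw [interior_Ico] at hy
      have hy' : y ∈ Ioo (rMin M H) (2 * M) := ⟨hR'.1.trans hy.1, hy.2⟩
      have hyc := Ioo_subset_Ico_self hy
      have h1 := (hd y hy).deriv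
      have h := psi_mono (psiLin_nonneg hM hH hy') (psiLin_add_nonneg hM hH hy')
        (halfBoost_nonneg hM hR' hyc) (halfBoost_lt hM hR hR' hlt hyc).le
        (halfBoost_le_one hM hR ⟨hlt.trans hy.1, hy.2⟩)
      exact (sub_nonneg.2 h).trans_eq h1.symm
  have h := hmono ⟨le_rfl, hR'.2⟩ hx hx.1
  simp only [height_self, halfBoost_self hM hR'] at h
  have h1 := boostWeight_mul_halfBoost_le hM hH hR (x := R') ⟨hlt.le, hR'.2⟩
  have h2 := halfBoost_lt hM hR hR' hlt hx
  have h3 : 0 < boostWeight M H x :=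
    div_pos (by have := (pos_of_mem hM hR').trans_le hx.1; positivity)
      (wFun_pos hM H ⟨hR'.1.trans_le hx.1, hx.2⟩)
  have h4 := mul_lt_mul_of_pos_left h2 h3
  linarith

end


/-! ### Limits of the height and its continuity in the throat radius -/

section
variable {M H R x r t : ℝ}

/-- The height is unbounded as `r → 2M`: since `√D ≤ -A`, it grows at least like
`-R log (2M - r)`. -/
theorem exists_lt_height (hM : 0 < M) (hR : R ∈ Ioo (rMin M H) (2 * M)) (t : ℝ) :
    ∃ x ∈ Ioo R (2 * M), t < height M H R x := by
  have hR0 := pos_of_mem hM hR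
  have hmono : MonotoneOn (fun y => height M H R y + R * Real.log (2 * M - y))
      (Ico R (2 * M)) := by
    have hlog : ∀ y ∈ Ico R (2 * M), HasDerivAt (fun y => R * Real.log (2 * M - y))
        (R * (-1 / (2 * M - y))) y := fun y hy =>
      ((((hasDerivAt_id y).const_sub (2 * M)).log (by simp only [id]; linarith [hy.2])).const_mul R)
    have hd : ∀ y ∈ Ioo R (2 * M), _ := fun y hy =>
      (hasDerivAt_height hM hR hy).add (hlog y (Ioo_subset_Ico_self hy))
    apply monotoneOn_of_deriv_nonneg (convex_Ico _ _)
    · exact (continuousOn_height hM hR).add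
        fun y hy => (hlog y hy).continuousAt.continuousWithinAt
    · intro y hy
      rw [interior_Ico] at hy
      exact (hd y hy).differentiableAt.differentiableWithinAt
    · intro y hy
      rw [interior_Ico] at hy
      refine le_of_le_of_eq ?_ (hd y hy).deriv.symm
      have h0 := hR0.trans hy.1
      have hA := aFun_kFun_lt hM hR hy
      have hP := pFun_pos h0 hy.2
      have hD := dFun_pos hM hR hy
      have hS := Real.sqrt_pos.2 hD
      have hSA : √(dFun M H (kFun M H R) y) ≤ -aFun H (kFun M H R) y := by
        rw [Real.sqrt_le_left (by linarith), dFun_eq _ h0.le hy.2.le]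
        nlinarith
      have hy2 : 0 < 2 * M - y := by linarith [hy.2]
      have e : y * -aFun H (kFun M H R) y / ((2 * M - y) * √(dFun M H (kFun M H R) y))
          + R * (-1 / (2 * M - y)) = (y * -aFun H (kFun M H R) y
            - R * √(dFun M H (kFun M H R) y)) /
            ((2 * M - y) * √(dFun M H (kFun M H R) y)) := by
        field_simp
        ring
      rw [e]
      apply div_nonneg _ (by positivity)
      nlinarith [hy.1]
  have hR2 : 0 < 2 * M - R := by linarith [hR.2]
  -- the radius `x` with `R (log (2M - R) - log (2M - x)) = |t| + 1`
  have hE : Real.exp (-(|t| + 1) / R) < 1 :=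
    Real.exp_lt_one_iff.2 (div_neg_of_neg_of_pos (by linarith [abs_nonneg t]) hR0)
  have hE0 := Real.exp_pos (-(|t| + 1) / R)
  have hx : 2 * M - (2 * M - R) * Real.exp (-(|t| + 1) / R) ∈ Ioo R (2 * M) :=
    ⟨by nlinarith, by nlinarith⟩
  refine ⟨_, hx, ?_⟩
  have h := hmono ⟨le_rfl, hR.2⟩ (Ioo_subset_Ico_self hx) hx.1.le
  simp only [height_self, sub_sub_cancel] at h
  rw [Real.log_mul hR2.ne' hE0.ne', Real.log_exp, mul_add, mul_div_cancel₀ _ hR0.ne'] at h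
  linarith [le_abs_self t]

/-- At `c = c_H` the function `D` has a double root at `r_H`. -/
theorem exists_dFun_cMin_le (hM : 0 < M) (H : ℝ) :
    ∃ K > 0, ∀ x ∈ Icc (rMin M H) (2 * M), dFun M H (cMin M H) x ≤ K * (x - rMin M H) ^ 2 := by
  set ρ := rMin M H with hρ
  have hr := (rMin_spec hM H).1
  let q : ℝ → ℝ := fun x => H ^ 2 * (x ^ 4 + 2 * x ^ 3 * ρ + 3 * x ^ 2 * ρ ^ 2 + 4 * x * ρ ^ 3
    + 5 * ρ ^ 4) + (2 * H * cMin M H - 2 * M) * (x + 2 * ρ) + (x ^ 2 + 2 * x * ρ + 3 * ρ ^ 2)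
  have hq : Continuous q := by fun_prop
  obtain ⟨K, hK⟩ := (isCompact_Icc (a := ρ) (b := 2 * M)).bddAbove_image hq.continuousOn
  refine ⟨max K 1, by positivity, fun x hx => ?_⟩
  have h1 : q x ≤ K := hK (mem_image_of_mem q hx)
  have h2 : dFun M H (cMin M H) ρ = 0 := by
    rw [dFun_eq _ hr.1.le hr.2.le, cMin, aFun, kFun_eq]
    ring
  have h3 : bFun M H (cMin M H) ρ ρ = 0 := by
    rw [cMin, bFun_self, wFun_rMin hM, mul_zero]
  have h4 : dFun M H (cMin M H) x = q x * (x - ρ) ^ 2 := by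
    rw [dFun_eq_add (R := ρ), h2]
    have : bFun M H (cMin M H) ρ x = bFun M H (cMin M H) ρ ρ + (x - ρ) * q x := by
      simp only [bFun, q]
      ring
    rw [this, h3]
    ring
  rw [h4]
  exact mul_le_mul_of_nonneg_right (h1.trans (le_max_left _ _)) (sq_nonneg _)

/-- At a fixed area radius the height is unbounded as the throat radius tends to `r_H`: since
`D ≤ K (r - r_H)²`, it grows at least like `κ log (r - r_H)` from the throat on. -/
theorem exists_lt_height_throat (hM : 0 < M) (hr : r ∈ Ioo (rMin M H) (2 * M)) (t : ℝ) :
    ∃ R ∈ Ioo (rMin M H) r, t < height M H R r := by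
  obtain ⟨K, hK0, hK⟩ := exists_dFun_cMin_le hM H
  set ρ := rMin M H with hρ
  have hρ0 := (rMin_spec hM H).1
  set κ := √(ρ ^ 5 / (2 * M)) / √K with hκ
  have hκ0 : 0 < κ := div_pos (Real.sqrt_pos.2 (by have := hρ0.1; positivity)) (Real.sqrt_pos.2 hK0)
  have hrρ : 0 < r - ρ := by linarith [hr.1]
  -- the throat radius `R` with `κ (log (r - ρ) - log (R - ρ)) = |t| + 1`
  have hE : Real.exp (-(|t| + 1) / κ) < 1 :=
    Real.exp_lt_one_iff.2 (div_neg_of_neg_of_pos (by linarith [abs_nonneg t]) hκ0)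
  have hE0 := Real.exp_pos (-(|t| + 1) / κ)
  have hRm : ρ + (r - ρ) * Real.exp (-(|t| + 1) / κ) ∈ Ioo ρ r := ⟨by nlinarith, by nlinarith⟩
  refine ⟨_, hRm, ?_⟩
  set R := ρ + (r - ρ) * Real.exp (-(|t| + 1) / κ) with hRdef
  have hR : R ∈ Ioo (rMin M H) (2 * M) := ⟨hRm.1, hRm.2.trans hr.2⟩
  have hmono : MonotoneOn (fun y => height M H R y - κ * Real.log (y - ρ))
      (Ico R (2 * M)) := by
    have hlog : ∀ y ∈ Ico R (2 * M), HasDerivAt (fun y => κ * Real.log (y - ρ))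
        (κ * (1 / (y - ρ))) y := fun y hy =>
      ((((hasDerivAt_id y).sub_const ρ).log
        (by simp only [id]; linarith [hy.1, hR.1])).const_mul κ)
    have hd : ∀ y ∈ Ioo R (2 * M), _ := fun y hy =>
      (hasDerivAt_height hM hR hy).sub (hlog y (Ioo_subset_Ico_self hy))
    apply monotoneOn_of_deriv_nonneg (convex_Ico _ _)
    · exact (continuousOn_height hM hR).sub
        fun y hy => (hlog y hy).continuousAt.continuousWithinAt
    · intro y hy
      rw [interior_Ico] at hy
      exact (hd y hy).differentiableAt.differentiableWithinAt
    · intro y hy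
      rw [interior_Ico] at hy
      refine le_of_le_of_eq ?_ (hd y hy).deriv.symm
      have h0 := (pos_of_mem hM hR).trans hy.1
      have hA := aFun_kFun_lt hM hR hy
      have hP := pFun_pos h0 hy.2
      have hD := dFun_pos hM hR hy
      have hS := Real.sqrt_pos.2 hD
      have hyρ : 0 < y - ρ := by linarith [hy.1, hR.1]
      have hy2 : 0 < 2 * M - y := by linarith [hy.2]
      have hSK : √(dFun M H (kFun M H R) y) ≤ √K * (y - ρ) := by
        have h1 : dFun M H (kFun M H R) y ≤ dFun M H (cMin M H) y := by
          rw [dFun_eq _ h0.le hy.2.le, dFun_eq _ h0.le hy.2.le]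
          have h2 := (kFun_mem_Ioo hM hR).1
          have h3 : aFun H (cMin M H) y ≤ aFun H (kFun M H R) y := by unfold aFun; linarith
          nlinarith
        have h2 := h1.trans (hK y ⟨by linarith, hy.2.le⟩)
        have h3 := Real.sqrt_le_sqrt h2
        rwa [Real.sqrt_mul hK0.le, Real.sqrt_sq hyρ.le] at h3
      have hnum : √(ρ ^ 5 / (2 * M)) ≤ y * -aFun H (kFun M H R) y / (2 * M - y) := by
        have h1 : √(ρ ^ 5 / (2 * M)) ≤ y * pFun M y / (2 * M - y) := by
          rw [Real.sqrt_le_left (by positivity), div_pow, mul_pow, pFun_sq h0.le hy.2.le]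
          have e : y ^ 2 * (y ^ 3 * (2 * M - y)) / (2 * M - y) ^ 2 = y ^ 5 / (2 * M - y) := by
            field_simp
          rw [e]
          have := hρ0.1
          gcongr <;> linarith
        refine h1.trans ?_
        gcongr
        linarith
      have e : κ * (1 / (y - ρ)) = √(ρ ^ 5 / (2 * M)) / (√K * (y - ρ)) := by
        rw [hκ, div_mul_div_comm, mul_one]
      rw [sub_nonneg, e, ← div_div (y * _)]
      exact div_le_div₀ ((Real.sqrt_nonneg _).trans hnum) hnum hS hSK
  have h := hmono ⟨le_rfl, hR.2⟩ ⟨hRm.2.le, hr.2⟩ hRm.2.le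
  have e : R - ρ = (r - ρ) * Real.exp (-(|t| + 1) / κ) := by rw [hRdef]; ring
  simp only [height_self, e] at h
  rw [Real.log_mul hrρ.ne' hE0.ne', Real.log_exp, mul_add, mul_div_cancel₀ _ hκ0.ne'] at h
  linarith [le_abs_self t]

theorem height_eq_mul_integral (M H R r : ℝ) :
    height M H R r = √(r - R) * ∫ w in (0 : ℝ)..1, heightDensity M H R (√(r - R) * w) := by
  rw [intervalIntegral.mul_integral_comp_mul_left, height, heightParam, mul_zero, mul_one]

/-- Rescaling the parameter to `[0, 1]` removes the dependence of the domain of integration on the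
throat radius. -/
theorem continuousOn_height_max (hM : 0 < M) (hr : r < 2 * M) :
    ContinuousOn (fun a => height M H a (max a r)) (Ioo (rMin M H) (2 * M)) := by
  rw [continuousOn_iff_continuous_domRestrict]
  -- the integration variable is clamped to `[0, 1]`, so that the integrand is continuous everywhere
  let cl : ℝ → ℝ := fun w => max 0 (min 1 w)
  have hcl : Continuous cl := by fun_prop
  have hcl0 : ∀ w, 0 ≤ cl w := fun w => le_max_left _ _
  have hcl1 : ∀ w, cl w ≤ 1 := fun w => max_le zero_le_one (min_le_left _ _)
  have e : (Ioo (rMin M H) (2 * M)).domRestrict (fun a => height M H a (max a r)) = fun a =>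
      √(max a.1 r - a.1) * ∫ w in (0 : ℝ)..1,
        heightDensity M H a.1 (√(max a.1 r - a.1) * cl w) := by
    funext a
    rw [domRestrict_apply, height_eq_mul_integral]
    congr 1
    apply intervalIntegral.integral_congr
    intro w hw
    rw [uIcc_of_le zero_le_one] at hw
    simp only [cl]
    rw [min_eq_right hw.2, max_eq_right hw.1]
  rw [e]
  have hmem : ∀ p : Ioo (rMin M H) (2 * M) × ℝ,
      p.1.1 + (√(max p.1.1 r - p.1.1) * cl p.2) ^ 2 ∈ Ico p.1.1 (2 * M) := by
    intro p
    have h1 : 0 ≤ max p.1.1 r - p.1.1 := sub_nonneg.2 (le_max_left _ _)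
    have h2 : max p.1.1 r < 2 * M := max_lt p.1.2.2 hr
    rw [mul_pow, Real.sq_sqrt h1]
    have h3 : cl p.2 ^ 2 ≤ 1 := pow_le_one₀ (hcl0 _) (hcl1 _)
    constructor <;> nlinarith [sq_nonneg (cl p.2)]
  have hcont : Continuous fun p : Ioo (rMin M H) (2 * M) × ℝ =>
      heightDensity M H p.1.1 (√(max p.1.1 r - p.1.1) * cl p.2) := by
    unfold heightDensity
    apply Continuous.div
    · unfold aFun kFun
      fun_prop
    · unfold bFun kFun
      fun_prop
    · intro p
      exact (mul_pos (by linarith [(hmem p).2])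
        (Real.sqrt_pos.2 (bFun_pos hM p.1.2 (hmem p)))).ne'
  apply Continuous.mul (by fun_prop)
  exact intervalIntegral.continuous_parametric_intervalIntegral_of_continuous' hcont 0 1

/-- The height extended past the throat by the strictly increasing function `r - R`, so that it is
strictly monotone in each variable on the whole of `(r_H, 2M)`. -/
def extHeight (M H R r : ℝ) : ℝ := height M H R (max R r) + min 0 (r - R)

theorem extHeight_of_le (h : R ≤ r) : extHeight M H R r = height M H R r := by
  rw [extHeight, max_eq_right h, min_eq_left (by linarith), add_zero]

theorem extHeight_of_ge (h : r ≤ R) : extHeight M H R r = r - R := by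
  rw [extHeight, max_eq_left h, min_eq_right (by linarith), height_self, zero_add]

theorem le_of_extHeight_nonneg (h : 0 ≤ extHeight M H R r) : R ≤ r := by
  by_contra! hlt
  rw [extHeight_of_ge hlt.le] at h
  linarith

theorem continuousOn_extHeight_radius (hM : 0 < M) (hR : R ∈ Ioo (rMin M H) (2 * M)) :
    ContinuousOn (extHeight M H R) (Iio (2 * M)) := by
  apply ContinuousOn.add
  · exact (continuousOn_height hM hR).comp (by fun_prop)
      fun y hy => ⟨le_max_left _ _, max_lt hR.2 hy⟩
  · fun_prop

theorem continuousOn_extHeight_throat (hM : 0 < M) (hr : r < 2 * M) :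
    ContinuousOn (fun R => extHeight M H R r) (Ioo (rMin M H) (2 * M)) :=
  (continuousOn_height_max hM hr).add (by fun_prop)

theorem strictMonoOn_extHeight (hM : 0 < M) (hR : R ∈ Ioo (rMin M H) (2 * M)) :
    StrictMonoOn (extHeight M H R) (Iio (2 * M)) := by
  intro x hx y hy hxy
  rcases le_or_gt R x with h | h
  · rw [extHeight_of_le h, extHeight_of_le (h.trans hxy.le)]
    exact strictMonoOn_height hM hR ⟨h, hx⟩ ⟨h.trans hxy.le, hy⟩ hxy
  · rw [extHeight_of_ge h.le]
    rcases le_or_gt R y with h' | h'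
    · rw [extHeight_of_le h']
      linarith [height_nonneg hM hR ⟨h', hy⟩]
    · rw [extHeight_of_ge h'.le]
      linarith

theorem strictAntiOn_extHeight (hM : 0 < M) (hH : -(1 / (6 * M)) ≤ H) (hr : r < 2 * M) :
    StrictAntiOn (fun R => extHeight M H R r) (Ioo (rMin M H) (2 * M)) := by
  intro x hx y hy hxy
  change extHeight M H y r < extHeight M H x r
  rcases le_or_gt y r with h | h
  · rw [extHeight_of_le h, extHeight_of_le (hxy.le.trans h)]
    exact height_lt hM hH hx hy hxy ⟨h, hr⟩
  · rw [extHeight_of_ge h.le]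
    rcases le_or_gt x r with h' | h'
    · rw [extHeight_of_le h']
      linarith [height_nonneg hM hx ⟨h', hr⟩]
    · rw [extHeight_of_ge h'.le]
      linarith

theorem exists_throat_extHeight_eq (hM : 0 < M) (hr : r ∈ Ioo (rMin M H) (2 * M)) (ht : 0 ≤ t) :
    ∃ R ∈ Ioo (rMin M H) (2 * M), extHeight M H R r = t := by
  obtain ⟨R, hR, hlt⟩ := exists_lt_height_throat hM hr t
  have hsub : Icc R r ⊆ Ioo (rMin M H) (2 * M) :=
    fun y hy => ⟨hR.1.trans_le hy.1, hy.2.trans_lt hr.2⟩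
  obtain ⟨y, hy, h⟩ := intermediate_value_Icc' hR.2.le
    ((continuousOn_extHeight_throat hM hr.2).mono hsub)
    (show t ∈ Icc (extHeight M H r r) (extHeight M H R r) by
      rw [extHeight_of_ge le_rfl, extHeight_of_le hR.2.le, sub_self]
      exact ⟨ht, hlt.le⟩)
  exact ⟨y, hsub hy, h⟩

theorem exists_radius_extHeight_eq (hM : 0 < M) (hR : R ∈ Ioo (rMin M H) (2 * M)) (ht : 0 ≤ t) :
    ∃ r ∈ Ioo (rMin M H) (2 * M), extHeight M H R r = t := by
  obtain ⟨x, hx, hlt⟩ := exists_lt_height hM hR t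
  have hsub : Icc R x ⊆ Ioo (rMin M H) (2 * M) :=
    fun y hy => ⟨hR.1.trans_le hy.1, hy.2.trans_lt hx.2⟩
  obtain ⟨y, hy, h⟩ := intermediate_value_Icc hx.1.le
    ((continuousOn_extHeight_radius hM hR).mono (hsub.trans Ioo_subset_Iio_self))
    (show t ∈ Icc (extHeight M H R R) (extHeight M H R x) by
      rw [extHeight_of_ge le_rfl, extHeight_of_le hx.1.le, sub_self]
      exact ⟨ht, hlt.le⟩)
  exact ⟨y, hsub hy, h⟩

/-- A function defined implicitly by an equation that is strictly monotone in the unknown is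
continuous as soon as the equation is continuous in the parameter. -/
theorem continuousOn_of_implicit {X : Type*} [TopologicalSpace X] {F : ℝ → X → ℝ} {g : X → ℝ}
    {s : Set X} {l u : ℝ} (hF : ∀ x ∈ s, StrictAntiOn (fun a => F a x) (Ioo l u))
    (hc : ∀ a ∈ Ioo l u, ContinuousOn (F a) s) (hg : ∀ x ∈ s, g x ∈ Ioo l u)
    (h0 : ∀ x ∈ s, F (g x) x = 0) : ContinuousOn g s := by
  intro x hx
  refine tendsto_order.2 ⟨fun a ha => ?_, fun a ha => ?_⟩
  · rcases le_or_gt a l with hal | hal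
    · filter_upwards [self_mem_nhdsWithin] with y hy using hal.trans_lt (hg y hy).1
    · have ham : a ∈ Ioo l u := ⟨hal, ha.trans (hg x hx).2⟩
      have h : 0 < F a x := by
        rw [← h0 x hx]
        exact hF x hx ham (hg x hx) ha
      filter_upwards [self_mem_nhdsWithin, (hc a ham x hx).eventually (lt_mem_nhds h)]
        with y hy hy'
      rw [← h0 y hy] at hy'
      exact ((hF y hy).lt_iff_gt (hg y hy) ham).1 hy'
  · rcases le_or_gt u a with hau | hau
    · filter_upwards [self_mem_nhdsWithin] with y hy using (hg y hy).2.trans_le hau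
    · have ham : a ∈ Ioo l u := ⟨(hg x hx).1.trans ha, hau⟩
      have h : F a x < 0 := by
        rw [← h0 x hx]
        exact hF x hx (hg x hx) ham ha
      filter_upwards [self_mem_nhdsWithin, (hc a ham x hx).eventually (gt_mem_nhds h)]
        with y hy hy'
      rw [← h0 y hy] at hy'
      exact ((hF y hy).lt_iff_gt ham (hg y hy)).1 hy'

end


/-! ### Schwarzschild coordinates on region II -/

/-- The point of region II with area radius `r` and Schwarzschild time `t`. -/
def kruskalII (M r t : ℝ) : ℝ × ℝ :=
  (-Real.exp (Real.log (2 * M - r) / 2 + (r - t) / (4 * M)),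
    Real.exp (Real.log (2 * M - r) / 2 + (r + t) / (4 * M)))

/-- The Schwarzschild time `2M log |V / U|` of a point of region II. -/
def timeII (M : ℝ) (p : ℝ × ℝ) : ℝ := 2 * M * (Real.log p.2 - Real.log (-p.1))

section
variable {M H R r t x u : ℝ}

theorem kruskalII_mul (hM : 0 < M) (h1 : r < 2 * M) (t : ℝ) :
    (kruskalII M r t).1 * (kruskalII M r t).2 = radialProfile M r := by
  have e : Real.log (2 * M - r) / 2 + (r - t) / (4 * M) +
      (Real.log (2 * M - r) / 2 + (r + t) / (4 * M)) = Real.log (2 * M - r) + r / (2 * M) := by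
    field_simp
    ring
  simp only [kruskalII, radialProfile]
  rw [neg_mul, ← Real.exp_add, e, Real.exp_add, Real.exp_log (by linarith)]
  ring

theorem radialProfile_gt (hM : 0 < M) (h0 : 0 < r) : -2 * M < radialProfile M r := by
  have h := radialProfile_strictMonoOn hM (self_mem_Ici (a := (0 : ℝ))) h0.le h0
  simpa [radialProfile] using h

theorem areaRadius_eq (hM : 0 < M) (h0 : 0 < r) {p : ℝ × ℝ} (hp : p.1 * p.2 = radialProfile M r) :
    areaRadius M p = r := by
  have h := areaRadius_spec hM (p := p) (hp ▸ radialProfile_gt hM h0)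
  exact (radialProfile_strictMonoOn hM).injOn h.1.le h0.le (h.2.trans hp)

theorem kruskalII_mem (hM : 0 < M) (h0 : 0 < r) (h1 : r < 2 * M) (t : ℝ) :
    kruskalII M r t ∈ regionII M :=
  ⟨neg_neg_of_pos (Real.exp_pos _), Real.exp_pos _,
    (radialProfile_gt hM h0).trans_eq (kruskalII_mul hM h1 t).symm⟩

theorem areaRadius_kruskalII (hM : 0 < M) (h0 : 0 < r) (h1 : r < 2 * M) (t : ℝ) :
    areaRadius M (kruskalII M r t) = r :=
  areaRadius_eq hM h0 (kruskalII_mul hM h1 t)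

theorem timeII_kruskalII (hM : 0 < M) (r t : ℝ) : timeII M (kruskalII M r t) = t := by
  simp only [timeII, kruskalII, neg_neg, Real.log_exp]
  field_simp
  ring

theorem areaRadius_mem_Ioo (hM : 0 < M) {p : ℝ × ℝ} (hp : p ∈ regionII M) :
    areaRadius M p ∈ Ioo 0 (2 * M) := by
  obtain ⟨h1, h2⟩ := areaRadius_spec hM hp.2.2
  refine ⟨h1, ?_⟩
  have h3 : radialProfile M (areaRadius M p) < radialProfile M (2 * M) := by
    rw [h2]
    simpa [radialProfile] using mul_neg_of_neg_of_pos hp.1 hp.2.1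
  exact ((radialProfile_strictMonoOn hM).lt_iff_lt h1.le (by positivity : 0 ≤ 2 * M)).1 h3

theorem kruskalII_areaRadius_timeII (hM : 0 < M) {p : ℝ × ℝ} (hp : p ∈ regionII M) :
    kruskalII M (areaRadius M p) (timeII M p) = p := by
  have hr := areaRadius_mem_Ioo hM hp
  have h2 := (areaRadius_spec hM hp.2.2).2
  set r := areaRadius M p
  have hU : 0 < -p.1 := neg_pos.2 hp.1
  have hlog : Real.log (-p.1) + Real.log p.2 = Real.log (2 * M - r) + r / (2 * M) := by
    rw [← Real.log_mul hU.ne' hp.2.1.ne', neg_mul, ← h2, radialProfile, ← neg_mul, neg_sub,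
      Real.log_mul (by linarith [hr.2]) (Real.exp_pos _).ne', Real.log_exp]
  have hlog' : Real.log (2 * M - r) = Real.log (-p.1) + Real.log p.2 - r / (2 * M) := by linarith
  have e1 : Real.log (2 * M - r) / 2 + (r - timeII M p) / (4 * M) = Real.log (-p.1) := by
    rw [hlog', timeII]
    field_simp
    ring
  have e2 : Real.log (2 * M - r) / 2 + (r + timeII M p) / (4 * M) = Real.log p.2 := by
    rw [hlog', timeII]
    field_simp
    ring
  ext
  · simp only [kruskalII]
    rw [e1, Real.exp_log hU, neg_neg]
  · simp only [kruskalII]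
    rw [e2, Real.exp_log hp.2.1]

theorem reflectT_kruskalII (M r t : ℝ) : reflectT (kruskalII M r t) = kruskalII M r (-t) := by
  simp [reflectT, kruskalII, sub_eq_add_neg]

/-! ### The trace of a leaf on region II -/

theorem fBar_eq (hM : 0 < M) (hR : R ∈ Ioo (rMin M H) (2 * M)) (hx : x ∈ Ioo R (2 * M)) :
    fBar M H (kFun M H R) x =
      x * -aFun H (kFun M H R) x / ((2 * M - x) * √(dFun M H (kFun M H R) x))
        + x / (x - 2 * M) := by
  have h0 := (pos_of_mem hM hR).trans hx.1
  have hP := pFun_pos h0 hx.2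
  have hA := aFun_kFun_lt hM hR hx
  have hD := dFun_pos hM hR hx
  have hS := Real.sqrt_pos.2 hD
  have hS2 := Real.sq_sqrt hD.le
  have hDA : dFun M H (kFun M H R) x
    = aFun H (kFun M H R) x ^ 2 + x ^ 3 * (x - 2 * M) := rfl
  have hy : x - 2 * M ≠ 0 := by linarith [hx.2]
  have hy' : 2 * M - x ≠ 0 := by linarith [hx.2]
  rw [fBar]
  nth_rewrite 1 [← hS2]
  rw [hDA] at hS2
  have e : √(dFun M H (kFun M H R) x) ^ 2 - aFun H (kFun M H R) x * √(dFun M H (kFun M H R) x) =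
      √(dFun M H (kFun M H R) x) * (√(dFun M H (kFun M H R) x) - aFun H (kFun M H R) x) := by ring
  have hne : √(dFun M H (kFun M H R) x) - aFun H (kFun M H R) x ≠ 0 := by linarith
  rw [e, hDA]
  rw [hDA] at hne hS
  set S := √(aFun H (kFun M H R) x ^ 2 + x ^ 3 * (x - 2 * M))
  set A := aFun H (kFun M H R) x
  rw [div_add_div _ _ (mul_ne_zero hy' hS.ne') hy, div_eq_div_iff (by positivity) (by positivity)]
  linear_combination (-(x * S * (2 * M - x))) * hS2

/-- The integrand `fBar` is unbounded at the throat; it is integrable as a nonnegative derivative of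
a continuous function. -/
theorem regularExponent_eq (hM : 0 < M) (hR : R ∈ Ioo (rMin M H) (2 * M))
    (hr : r ∈ Ico R (2 * M)) :
    regularExponent M R (fBar M H (kFun M H R)) r =
      r + 2 * M * Real.log (2 * M - r) + height M H R r := by
  let F : ℝ → ℝ := fun x => x + 2 * M * Real.log (2 * M - x) + height M H R x
  have hsub : Icc R r ⊆ Ico R (2 * M) := fun y hy => ⟨hy.1, hy.2.trans_lt hr.2⟩
  have hlog : ∀ x < 2 * M, HasDerivAt (fun x => x + 2 * M * Real.log (2 * M - x))
      (x / (x - 2 * M)) x := by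
    intro x hx
    have h1 : 2 * M - x ≠ 0 := by linarith
    have h2 : x - 2 * M ≠ 0 := by linarith
    refine ((hasDerivAt_id x).add ((((hasDerivAt_id x).const_sub (2 * M)).log h1).const_mul
      (2 * M))).congr_deriv ?_
    simp only [id]
    field_simp
    ring
  have hcont : ContinuousOn F (Icc R r) :=
    ContinuousOn.add (fun x hx => (hlog x (hsub hx).2).continuousAt.continuousWithinAt)
      ((continuousOn_height hM hR).mono hsub)
  have hderiv : ∀ x ∈ Ioo R r, HasDerivAt F (fBar M H (kFun M H R) x) x := by
    intro x hx
    have hx' : x ∈ Ioo R (2 * M) := ⟨hx.1, hx.2.trans hr.2⟩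
    rw [fBar_eq hM hR hx', add_comm (_ / _)]
    exact (hlog x hx'.2).add (hasDerivAt_height hM hR hx')
  have hpos : ∀ x ∈ Ioo R r, 0 ≤ fBar M H (kFun M H R) x := by
    intro x hx
    have hx' : x ∈ Ioo R (2 * M) := ⟨hx.1, hx.2.trans hr.2⟩
    have h0 := (pos_of_mem hM hR).trans hx.1
    have := aFun_kFun_lt hM hR hx'
    have := pFun_pos h0 hx'.2
    have := mul_nonneg (show 0 ≤ -aFun H (kFun M H R) x by linarith)
      (Real.sqrt_nonneg (dFun M H (kFun M H R) x))
    exact div_nonneg (by positivity) (by linarith [dFun_pos hM hR hx'])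
  have hint : IntervalIntegrable (fBar M H (kFun M H R)) MeasureTheory.volume R r := by
    apply intervalIntegral.intervalIntegrable_deriv_of_nonneg (g := F)
    · rwa [uIcc_of_le hr.1]
    · rwa [min_eq_left hr.1, max_eq_right hr.1]
    · rwa [min_eq_left hr.1, max_eq_right hr.1]
  rw [regularExponent, intervalIntegral.integral_eq_sub_of_hasDerivAt_of_le hr.1 hcont hderiv hint,
    abs_sub_comm, abs_of_pos (by linarith [hR.2])]
  simp only [F, height_self]
  ring

theorem rPlus_kFun (hM : 0 < M) (hR : R ∈ Ioo (rMin M H) (2 * M)) :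
    rPlus M H (kFun M H R) = R := by
  obtain ⟨h1, h2⟩ := rPlus_spec hM (kFun_mem_Ioo hM hR)
  exact (strictMonoOn_kFun hM H).injOn (Ioo_subset_Icc_self h1) (Ioo_subset_Icc_self hR) h2

theorem plusHalf_eq (hM : 0 < M) (hR : R ∈ Ioo (rMin M H) (2 * M)) (hr : r ∈ Ico R (2 * M)) :
    plusHalf M H (kFun M H R) r = kruskalII M r (height M H R r) := by
  have hy : 0 < 2 * M - r := by linarith [hr.2]
  rw [plusHalf, rPlus_kFun hM hR, regularExponent_eq hM hR hr]
  ext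
  · have e : r - 2 * M = -Real.exp (Real.log (2 * M - r)) := by rw [Real.exp_log hy]; ring
    simp only [kruskalII]
    nth_rewrite 1 [e]
    rw [neg_mul, ← Real.exp_add]
    congr 2
    field_simp
    ring
  · simp only [kruskalII]
    congr 1
    field_simp
    ring

/-- The part in region II of the leaf with throat radius `R`, as a curve through the throat. -/
def leafCurve (M H R u : ℝ) : ℝ × ℝ := kruskalII M (R + u ^ 2) (heightParam M H R u)

theorem leafCurve_neg : leafCurve M H R (-u) = reflectT (leafCurve M H R u) := by
  rw [leafCurve, leafCurve, reflectT_kruskalII, heightParam_neg, neg_sq]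

theorem leafCurve_mem (hM : 0 < M) (hR : R ∈ Ioo (rMin M H) (2 * M))
    (hu : u ∈ throatInterval M R) : leafCurve M H R u ∈ regionII M :=
  kruskalII_mem hM (by have := pos_of_mem hM hR; positivity) (mem_throatInterval.1 hu) _

theorem leafCurve_sqrt (hr : R ≤ r) :
    leafCurve M H R (√(r - R)) = kruskalII M r (height M H R r) := by
  rw [leafCurve, Real.sq_sqrt (by linarith), height, add_sub_cancel]

theorem sigmaPlus_inter_regionII (hM : 0 < M) (hR : R ∈ Ioo (rMin M H) (2 * M)) :
    sigmaPlus M H (kFun M H R) ∩ regionII M = leafCurve M H R '' throatInterval M R := by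
  have hc := kFun_mem_Ioo hM hR
  rw [sigmaPlus, if_neg hc.2.ne, rPlus_kFun hM hR]
  have hlt : ∀ r, (plusHalf M H (kFun M H R) r).1 < 0 → r < 2 * M := by
    intro r h
    by_contra! hr
    exact absurd h (not_lt.2 (mul_nonneg (by linarith) (Real.exp_pos _).le))
  apply Subset.antisymm
  · rintro p ⟨⟨r, hr, rfl⟩ | ⟨q, ⟨r, hr, rfl⟩, rfl⟩, hp⟩
    · have hr' : r ∈ Ico R (2 * M) := ⟨hr, hlt r hp.1⟩
      rw [plusHalf_eq hM hR hr', ← leafCurve_sqrt hr'.1]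
      exact mem_image_of_mem _ (sqrt_mem_throatInterval hr')
    · have hr' : r ∈ Ico R (2 * M) := ⟨hr, hlt r (neg_pos.1 hp.2.1)⟩
      rw [plusHalf_eq hM hR hr', ← leafCurve_sqrt hr'.1, ← leafCurve_neg]
      apply mem_image_of_mem
      rw [mem_throatInterval, neg_sq]
      exact mem_throatInterval.1 (sqrt_mem_throatInterval hr')
  · rintro p ⟨u, hu, rfl⟩
    refine ⟨?_, leafCurve_mem hM hR hu⟩
    have hr := mem_Ico_of_mem_throatInterval hu
    have key : leafCurve M H R |u| = plusHalf M H (kFun M H R) (R + u ^ 2) := by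
      rw [plusHalf_eq hM hR hr, ← leafCurve_sqrt hr.1, add_sub_cancel_left, Real.sqrt_sq_eq_abs]
    rcases le_total 0 u with h | h
    · rw [abs_of_nonneg h] at key
      exact Or.inl ⟨_, hr.1, key.symm⟩
    · rw [abs_of_nonpos h] at key
      refine Or.inr ⟨_, ⟨_, hr.1, rfl⟩, ?_⟩
      rw [← key, ← leafCurve_neg, neg_neg]

/-- The leaf through the origin does not meet region II, as `U` and `V` do not have opposite signs
on it. -/
theorem sigmaPlus_origin_inter_regionII (M H : ℝ) :
    sigmaPlus M H (-8 * M ^ 3 * H) ∩ regionII M = ∅ := by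
  rw [sigmaPlus, if_pos rfl, sigmaOrigin, eq_empty_iff_forall_notMem]
  have hnn : ∀ r, 0 ≤ (originHalf M H r).1 ∧ 0 ≤ (originHalf M H r).2 := fun r =>
    ⟨mul_nonneg (Real.sqrt_nonneg _) (Real.exp_pos _).le,
      mul_nonneg (Real.sqrt_nonneg _) (Real.exp_pos _).le⟩
  rintro p ⟨⟨r, -, rfl⟩ | ⟨q, ⟨r, -, rfl⟩, rfl⟩, hp⟩
  · exact absurd hp.1 (not_lt.2 (hnn r).1)
  · exact absurd (neg_pos.1 hp.2.1) (not_lt.2 (hnn r).1)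

end


/-! ### The mean curvature of a leaf -/

/-- The mean curvature in terms of the logarithmic derivatives `a` of `U` and `b` of `V`. -/
theorem meanCurvature_of_log_deriv {M x s a a₁ b b₁ : ℝ} {u v : ℝ → ℝ} (hM : 0 < M) (hx : 0 < x)
    (hu : u s ≠ 0) (hv : v s ≠ 0) (ha : a ≠ 0) (hb : b ≠ 0)
    (hprod : u s * v s = radialProfile M x)
    (hu₁ : deriv u s = u s * a) (hu₂ : deriv (deriv u) s = u s * (a ^ 2 + a₁))
    (hv₁ : deriv v s = v s * b) (hv₂ : deriv (deriv v) s = v s * (b ^ 2 + b₁)) :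
    meanCurvature M u v s =
      (1 / 3) * ((b₁ / b - a₁ / a + b - a) / 2
        + (3 / (2 * x) - 1 / (4 * M)) * (2 * M * (1 - 2 * M / x) * (b - a)))
        / √(16 * M ^ 2 * (1 - 2 * M / x) * (a * b)) := by
  have hr : areaRadius M (u s, v s) = x := areaRadius_eq hM hx hprod
  have hF : confFactor M x * (u s * v s) = 16 * M ^ 2 * (1 - 2 * M / x) := by
    have h1 : Real.exp (-x / (2 * M)) * Real.exp (x / (2 * M)) = 1 := by
      rw [← Real.exp_add, neg_div, neg_add_cancel, Real.exp_zero]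
    rw [hprod, confFactor, radialProfile, div_mul_eq_mul_div, div_eq_iff hx.ne']
    have h2 : (1 - 2 * M / x) * x = x - 2 * M := by field_simp
    linear_combination (16 * M ^ 2 * (x - 2 * M)) * h1 - (16 * M ^ 2) * h2
  have hN : normalRadius M u v s = 2 * M * (1 - 2 * M / x) * (b - a) := by
    rw [normalRadius, hr, hu₁, hv₁]
    have e : confFactor M x / (8 * M) * (u s * (v s * b) - v s * (u s * a)) =
        confFactor M x * (u s * v s) * (b - a) / (8 * M) := by ring
    rw [e, hF]
    field_simp
    ring
  have hS : confFactor M x * (u s * a * (v s * b)) = 16 * M ^ 2 * (1 - 2 * M / x) * (a * b) := by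
    rw [← hF]
    ring
  have e1 : u s * (a ^ 2 + a₁) / (u s * a) = a + a₁ / a := by field_simp
  have e2 : v s * (b ^ 2 + b₁) / (v s * b) = b + b₁ / b := by field_simp
  simp only [meanCurvature, hr, hN]
  rw [hu₂, hv₂, hu₁, hv₁, hS, e1, e2]
  congr 2
  field_simp
  ring

/-- The quantity `-A / √B` along a leaf; the slopes of `log (-U)` and `log V` are
`∓ x / (2M (2M - x)) * (slopeFun ± u)`. -/
def slopeFun (M H R u : ℝ) : ℝ :=
  -aFun H (kFun M H R) (R + u ^ 2) / √(bFun M H (kFun M H R) R (R + u ^ 2))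

section
variable {M H R u : ℝ}

theorem hasDerivAt_radius (R u : ℝ) : HasDerivAt (fun w : ℝ => R + w ^ 2) (2 * u) u := by
  refine ((hasDerivAt_pow 2 u).const_add R).congr_deriv ?_
  push_cast
  ring

theorem slopeFun_sq (hM : 0 < M) (hR : R ∈ Ioo (rMin M H) (2 * M))
    (hu : u ∈ throatInterval M R) :
    slopeFun M H R u ^ 2 - u ^ 2 = (R + u ^ 2) ^ 3 * (2 * M - (R + u ^ 2)) /
      bFun M H (kFun M H R) R (R + u ^ 2) := by
  have hx := mem_Ico_of_mem_throatInterval hu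
  have hB := bFun_pos hM hR hx
  have hD := dFun_eq_mul (x := R + u ^ 2) hM hR
  rw [slopeFun, div_pow, Real.sq_sqrt hB.le, eq_div_iff hB.ne', sub_mul, div_mul_cancel₀ _ hB.ne']
  rw [dFun, add_sub_cancel_left] at hD
  linear_combination hD

theorem abs_lt_slopeFun (hM : 0 < M) (hR : R ∈ Ioo (rMin M H) (2 * M))
    (hu : u ∈ throatInterval M R) : |u| < slopeFun M H R u := by
  have hx := mem_Ico_of_mem_throatInterval hu
  have h0 := (pos_of_mem hM hR).trans_le hx.1
  have hB := bFun_pos hM hR hx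
  have h1 : 0 ≤ slopeFun M H R u :=
    div_nonneg (by linarith [aFun_kFun_le hM hR hx, pFun_pos h0 hx.2]) (Real.sqrt_nonneg _)
  have h2 := slopeFun_sq hM hR hu
  have h3 : 0 < (R + u ^ 2) ^ 3 * (2 * M - (R + u ^ 2)) /
      bFun M H (kFun M H R) R (R + u ^ 2) := by
    have := hx.2
    exact div_pos (mul_pos (by positivity) (by linarith)) hB
  exact abs_lt_of_sq_lt_sq (by linarith) h1

/-- The derivative of `slopeFun`, in the form in which it enters the mean curvature. -/
theorem exists_hasDerivAt_slopeFun (hM : 0 < M) (hR : R ∈ Ioo (rMin M H) (2 * M))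
    (hu : u ∈ throatInterval M R) : ∃ d, HasDerivAt (slopeFun M H R) d u ∧
      (d * u - slopeFun M H R u) * bFun M H (kFun M H R) R (R + u ^ 2) =
        6 * H * (R + u ^ 2) ^ 2 * ((R + u ^ 2) ^ 3 * (2 * M - (R + u ^ 2))) /
          √(bFun M H (kFun M H R) R (R + u ^ 2)) -
        slopeFun M H R u * (4 * (R + u ^ 2) ^ 3 - 6 * M * (R + u ^ 2) ^ 2) := by
  set c := kFun M H R with hc
  have hx := mem_Ico_of_mem_throatInterval hu
  have hB := bFun_pos hM hR hx
  have hS := Real.sqrt_pos.2 hB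
  have hS2 := Real.sq_sqrt hB.le
  have hD := dFun_eq_mul (x := R + u ^ 2) hM hR
  rw [add_sub_cancel_left] at hD
  have hA := (hasDerivAt_aFun H c (R + u ^ 2)).comp u (hasDerivAt_radius R u)
  obtain ⟨b', hb'⟩ : ∃ b', HasDerivAt (bFun M H c R) b' (R + u ^ 2) := by
    have : Differentiable ℝ (bFun M H c R) := by unfold bFun; fun_prop
    exact ⟨_, (this _).hasDerivAt⟩
  -- differentiating `D(x) = D(R) + (x - R) B(x)`
  have hrel : 6 * H * (R + u ^ 2) ^ 2 * aFun H c (R + u ^ 2) +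
      (4 * (R + u ^ 2) ^ 3 - 6 * M * (R + u ^ 2) ^ 2) =
      bFun M H c R (R + u ^ 2) + u ^ 2 * b' := by
    have h1 : HasDerivAt (dFun M H c)
        (6 * H * (R + u ^ 2) ^ 2 * aFun H c (R + u ^ 2) +
          (4 * (R + u ^ 2) ^ 3 - 6 * M * (R + u ^ 2) ^ 2)) (R + u ^ 2) := by
      refine (((hasDerivAt_aFun H c (R + u ^ 2)).pow 2).add
        ((hasDerivAt_pow 3 (R + u ^ 2)).mul
          ((hasDerivAt_id (R + u ^ 2)).sub_const (2 * M)))).congr_deriv ?_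
      simp only [id]
      push_cast
      ring
    have h2 : HasDerivAt (dFun M H c) (1 * bFun M H c R (R + u ^ 2) + (R + u ^ 2 - R) * b')
        (R + u ^ 2) := by
      have h := (((hasDerivAt_id (R + u ^ 2)).sub_const R).mul hb').const_add (dFun M H c R)
      have e : dFun M H c = fun x => dFun M H c R + ((fun y => id y - R) * bFun M H c R) x :=
        funext fun x => dFun_eq_add c
      rw [e]
      exact h
    have h3 := h1.unique h2
    rw [h3]
    ring
  have hQ := (hA.neg).div ((hb'.comp u (hasDerivAt_radius R u)).sqrt
    (show (bFun M H c R ∘ fun w : ℝ => R + w ^ 2) u ≠ 0 from hB.ne')) hS.ne'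
  refine ⟨_, hQ, ?_⟩
  simp only [slopeFun, Pi.neg_apply, Function.comp_apply, ← hc]
  rw [dFun] at hD
  set B := bFun M H c R (R + u ^ 2)
  set A := aFun H c (R + u ^ 2)
  set x := R + u ^ 2
  set S := √B
  have hB' : B = S ^ 2 := hS2.symm
  rw [hB'] at hD hrel
  rw [hB']
  have hS0 := hS.ne'
  field_simp
  linear_combination (6 * H * x ^ 2) * hD - A * hrel

theorem heightDensity_eq (M H R u : ℝ) : heightDensity M H R u =
    2 * ((R + u ^ 2) / (2 * M - (R + u ^ 2))) * slopeFun M H R u := by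
  rw [heightDensity, slopeFun, mul_div_assoc', mul_div_assoc', div_mul_eq_mul_div, div_div]

/-- The logarithmic derivative of `U` along a leaf. -/
def logDerivU (M H R u : ℝ) : ℝ :=
  -((R + u ^ 2) / (2 * M - (R + u ^ 2))) / (2 * M) * (slopeFun M H R u + u)

/-- The logarithmic derivative of `V` along a leaf. -/
def logDerivV (M H R u : ℝ) : ℝ :=
  (R + u ^ 2) / (2 * M - (R + u ^ 2)) / (2 * M) * (slopeFun M H R u - u)

theorem hasDerivAt_leafCurve_fst (hM : 0 < M) (hR : R ∈ Ioo (rMin M H) (2 * M))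
    (hu : u ∈ throatInterval M R) :
    HasDerivAt (fun w => (leafCurve M H R w).1) ((leafCurve M H R u).1 * logDerivU M H R u) u := by
  have hx := mem_Ico_of_mem_throatInterval hu
  have hy : 2 * M - (R + u ^ 2) ≠ 0 := by linarith [hx.2]
  have h := (((((hasDerivAt_radius R u).const_sub (2 * M)).log hy).div_const 2).add
    (((hasDerivAt_radius R u).sub (hasDerivAt_heightParam hM hR hu)).div_const (4 * M))).exp.neg
  refine h.congr_deriv ?_
  simp only [leafCurve, kruskalII, logDerivU, heightDensity_eq, Pi.add_apply, Pi.sub_apply]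
  rw [neg_mul]
  congr 2
  field_simp
  ring

theorem hasDerivAt_leafCurve_snd (hM : 0 < M) (hR : R ∈ Ioo (rMin M H) (2 * M))
    (hu : u ∈ throatInterval M R) :
    HasDerivAt (fun w => (leafCurve M H R w).2) ((leafCurve M H R u).2 * logDerivV M H R u) u := by
  have hx := mem_Ico_of_mem_throatInterval hu
  have hy : 2 * M - (R + u ^ 2) ≠ 0 := by linarith [hx.2]
  have h := (((((hasDerivAt_radius R u).const_sub (2 * M)).log hy).div_const 2).add
    (((hasDerivAt_radius R u).add (hasDerivAt_heightParam hM hR hu)).div_const (4 * M))).exp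
  refine h.congr_deriv ?_
  simp only [leafCurve, kruskalII, logDerivV, heightDensity_eq, Pi.add_apply]
  congr 1
  field_simp
  ring

theorem logDerivU_neg (hM : 0 < M) (hR : R ∈ Ioo (rMin M H) (2 * M))
    (hu : u ∈ throatInterval M R) : logDerivU M H R u < 0 := by
  have hx := mem_Ico_of_mem_throatInterval hu
  have h0 := (pos_of_mem hM hR).trans_le hx.1
  have hy : 0 < 2 * M - (R + u ^ 2) := by linarith [hx.2]
  have h := abs_lt.1 (abs_lt_slopeFun hM hR hu)
  rw [logDerivU, neg_div, neg_mul, neg_lt_zero]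
  exact mul_pos (by positivity) (by linarith)

theorem logDerivV_pos (hM : 0 < M) (hR : R ∈ Ioo (rMin M H) (2 * M))
    (hu : u ∈ throatInterval M R) : 0 < logDerivV M H R u := by
  have hx := mem_Ico_of_mem_throatInterval hu
  have h0 := (pos_of_mem hM hR).trans_le hx.1
  have hy : 0 < 2 * M - (R + u ^ 2) := by linarith [hx.2]
  have h := abs_lt.1 (abs_lt_slopeFun hM hR hu)
  exact mul_pos (by positivity) (by linarith)

theorem meanCurvature_leafCurve (hM : 0 < M) (hR : R ∈ Ioo (rMin M H) (2 * M))
    (hu : u ∈ throatInterval M R) :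
    meanCurvature M (fun w => (leafCurve M H R w).1) (fun w => (leafCurve M H R w).2) u = H := by
  have hx := mem_Ico_of_mem_throatInterval hu
  have h0 := (pos_of_mem hM hR).trans_le hx.1
  have hy : 0 < 2 * M - (R + u ^ 2) := by linarith [hx.2]
  have hB := bFun_pos hM hR hx
  have hS := Real.sqrt_pos.2 hB
  have hS2 := Real.sq_sqrt hB.le
  have hslope := abs_lt.1 (abs_lt_slopeFun hM hR hu)
  have hsq := slopeFun_sq hM hR hu
  obtain ⟨d, hd, hrel⟩ := exists_hasDerivAt_slopeFun hM hR hu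
  have hU := (leafCurve_mem hM hR hu).1
  have hV := (leafCurve_mem hM hR hu).2.1
  -- the derivative of `x / (2M - x)` along the leaf
  have hq : HasDerivAt (fun w : ℝ => (R + w ^ 2) / (2 * M - (R + w ^ 2)))
      (4 * M * u / (2 * M - (R + u ^ 2)) ^ 2) u := by
    refine ((hasDerivAt_radius R u).div ((hasDerivAt_radius R u).const_sub (2 * M))
      hy.ne').congr_deriv ?_
    ring
  have ha := (hq.neg.div_const (2 * M)).mul (hd.add (hasDerivAt_id u))
  have hb := (hq.div_const (2 * M)).mul (hd.sub (hasDerivAt_id u))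
  have hev : ∀ᶠ w in nhds u, w ∈ throatInterval M R := isOpen_Ioo.mem_nhds hu
  have hu₂ : deriv (deriv fun w => (leafCurve M H R w).1) u = (leafCurve M H R u).1 *
      (logDerivU M H R u ^ 2 + (-(4 * M * u / (2 * M - (R + u ^ 2)) ^ 2) / (2 * M) *
        (slopeFun M H R u + u) +
        -((R + u ^ 2) / (2 * M - (R + u ^ 2))) / (2 * M) * (d + 1))) := by
    have e : (deriv fun w => (leafCurve M H R w).1) =ᶠ[nhds u]
        fun w => (leafCurve M H R w).1 * logDerivU M H R w :=
      hev.mono fun w hw => (hasDerivAt_leafCurve_fst hM hR hw).deriv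
    rw [e.deriv_eq]
    have h : deriv (fun w => (leafCurve M H R w).1 * logDerivU M H R w) u = _ :=
      ((hasDerivAt_leafCurve_fst hM hR hu).mul ha).deriv
    rw [h]
    simp only [logDerivU, Pi.add_apply, Pi.mul_apply, Pi.neg_apply, id]
    ring
  have hv₂ : deriv (deriv fun w => (leafCurve M H R w).2) u = (leafCurve M H R u).2 *
      (logDerivV M H R u ^ 2 + (4 * M * u / (2 * M - (R + u ^ 2)) ^ 2 / (2 * M) *
        (slopeFun M H R u - u) +
        (R + u ^ 2) / (2 * M - (R + u ^ 2)) / (2 * M) * (d - 1))) := by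
    have e : (deriv fun w => (leafCurve M H R w).2) =ᶠ[nhds u]
        fun w => (leafCurve M H R w).2 * logDerivV M H R w :=
      hev.mono fun w hw => (hasDerivAt_leafCurve_snd hM hR hw).deriv
    rw [e.deriv_eq]
    have h : deriv (fun w => (leafCurve M H R w).2 * logDerivV M H R w) u = _ :=
      ((hasDerivAt_leafCurve_snd hM hR hu).mul hb).deriv
    rw [h]
    simp only [logDerivV, Pi.sub_apply, Pi.mul_apply, id]
    ring
  rw [meanCurvature_of_log_deriv (u := fun w => (leafCurve M H R w).1)
    (v := fun w => (leafCurve M H R w).2) hM h0 hU.ne hV.ne' (logDerivU_neg hM hR hu).ne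
    (logDerivV_pos hM hR hu).ne' (kruskalII_mul hM hx.2 _)
    (hasDerivAt_leafCurve_fst hM hR hu).deriv hu₂ (hasDerivAt_leafCurve_snd hM hR hu).deriv hv₂]
  set x := R + u ^ 2
  set B := bFun M H (kFun M H R) R x
  set S := √B
  set α := slopeFun M H R u
  have hy' : 2 * M - x ≠ 0 := hy.ne'
  have hla : logDerivU M H R u = -(x / (2 * M - x)) / (2 * M) * (α + u) := rfl
  have hlb : logDerivV M H R u = x / (2 * M - x) / (2 * M) * (α - u) := rfl
  have hα1 : α + u ≠ 0 := by linarith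
  have hα2 : α - u ≠ 0 := by linarith
  have hroot : √(16 * M ^ 2 * (1 - 2 * M / x) * (logDerivU M H R u * logDerivV M H R u)) =
      2 * x ^ 2 / S := by
    rw [Real.sqrt_eq_iff_mul_self_eq_of_pos (by positivity)]
    have e : 16 * M ^ 2 * (1 - 2 * M / x) * (logDerivU M H R u * logDerivV M H R u) =
        4 * (x / (2 * M - x)) * (α ^ 2 - u ^ 2) := by
      have h1 : 1 - 2 * M / x = -(2 * M - x) / x := by field_simp; ring
      rw [hla, hlb, h1]
      generalize 2 * M - x = y at hy' ⊢
      field_simp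
      ring
    rw [e, hsq, div_mul_div_comm, ← pow_two S, hS2]
    field_simp
    ring
  rw [hroot]
  have hb1 : (4 * M * u / (2 * M - x) ^ 2 / (2 * M) * (α - u) +
      x / (2 * M - x) / (2 * M) * (d - 1)) / logDerivV M H R u
      = 4 * M * u / (x * (2 * M - x)) + (d - 1) / (α - u) := by
    rw [hlb]
    generalize 2 * M - x = y at hy' ⊢
    field_simp
  have ha1 : (-(4 * M * u / (2 * M - x) ^ 2) / (2 * M) * (α + u) +
      -(x / (2 * M - x)) / (2 * M) * (d + 1)) / logDerivU M H R u
      = 4 * M * u / (x * (2 * M - x)) + (d + 1) / (α + u) := by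
    rw [hla]
    generalize 2 * M - x = y at hy' ⊢
    field_simp
    ring
  have hba : logDerivV M H R u - logDerivU M H R u = x / (2 * M - x) * α / M := by
    rw [hla, hlb]
    field_simp
    ring
  have hfrac : (d - 1) / (α - u) - (d + 1) / (α + u) = 2 * (d * u - α) / (α ^ 2 - u ^ 2) := by
    have : α ^ 2 - u ^ 2 ≠ 0 := by
      have := mul_ne_zero hα1 hα2
      intro h
      apply this
      linear_combination h
    field_simp
    ring
  have hfrac2 : (d * u - α) / (α ^ 2 - u ^ 2) = 6 * H * x ^ 2 / S
      - α * (4 * x - 6 * M) / (x * (2 * M - x)) := by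
    rw [hsq, div_div_eq_mul_div, hrel]
    field_simp
  have htot : (4 * M * u / (x * (2 * M - x)) + (d - 1) / (α - u) -
      (4 * M * u / (x * (2 * M - x)) + (d + 1) / (α + u)) + logDerivV M H R u -
      logDerivU M H R u) / 2 + (3 / (2 * x) - 1 / (4 * M)) *
        (2 * M * (1 - 2 * M / x) * (logDerivV M H R u - logDerivU M H R u)) =
      6 * H * x ^ 2 / S := by
    have e : 6 * H * x ^ 2 / S = (d * u - α) / (α ^ 2 - u ^ 2)
      + α * (4 * x - 6 * M) / (x * (2 * M - x)) := by rw [hfrac2]; ring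
    rw [e, hba, add_sub_assoc, hba, add_sub_add_left_eq_sub, hfrac]
    field_simp
    ring
  rw [hb1, ha1, htot]
  field_simp
  ring

theorem contDiffOn_leafCurve (hM : 0 < M) (hR : R ∈ Ioo (rMin M H) (2 * M)) :
    ContDiffOn ℝ (⊤ : ℕ∞) (leafCurve M H R) (throatInterval M R) := by
  have hh := contDiffOn_heightParam hM hR
  have hlog : ContDiffOn ℝ (⊤ : ℕ∞) (fun w => Real.log (2 * M - (R + w ^ 2)))
      (throatInterval M R) :=
    ContDiffOn.log (by fun_prop) fun w hw => by linarith [mem_throatInterval.1 hw]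
  unfold leafCurve kruskalII
  exact ((hlog.div_const 2).add ((ContDiffOn.sub (by fun_prop) hh).div_const _)).exp.neg.prodMk
    ((hlog.div_const 2).add ((ContDiffOn.add (by fun_prop) hh).div_const _)).exp

theorem isTSSCMC_leafCurve (hM : 0 < M) (hR : R ∈ Ioo (rMin M H) (2 * M)) :
    IsTSSCMC M H (leafCurve M H R '' throatInterval M R) := by
  refine ⟨⟨?_, fun p _ => ⟨univ, isOpen_univ, mem_univ p, -√(2 * M - R), √(2 * M - R),
    fun w => (leafCurve M H R w).1, fun w => (leafCurve M H R w).2,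
    contDiff_fst.comp_contDiffOn (contDiffOn_leafCurve hM hR),
    contDiff_snd.comp_contDiffOn (contDiffOn_leafCurve hM hR), fun s hs => ⟨?_, ?_, ?_⟩,
    (inter_univ _).symm⟩⟩, ?_⟩
  · rintro p ⟨u, hu, rfl⟩
    exact (leafCurve_mem hM hR hu).2.2
  · rw [(hasDerivAt_leafCurve_fst hM hR hs).deriv]
    exact mul_pos_of_neg_of_neg (leafCurve_mem hM hR hs).1 (logDerivU_neg hM hR hs)
  · rw [(hasDerivAt_leafCurve_snd hM hR hs).deriv]
    exact mul_pos (leafCurve_mem hM hR hs).2.1 (logDerivV_pos hM hR hs)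
  · exact meanCurvature_leafCurve hM hR hs
  · rintro p ⟨u, hu, rfl⟩
    refine ⟨-u, ?_, leafCurve_neg⟩
    rw [mem_throatInterval, neg_sq]
    exact mem_throatInterval.1 hu

end


/-! ### The foliation of region II -/

/-- The throat radius of the leaf through a point of region II. -/
def throatRadius (M H : ℝ) (p : ℝ × ℝ) : ℝ :=
  Function.invFunOn (fun R => extHeight M H R (areaRadius M p)) (Ioo (rMin M H) (2 * M))
    |timeII M p|

/-- The area radius at which the leaf with parameter `q.2` has Schwarzschild time
`± q.1`. -/
def leafRadius (M H : ℝ) (q : ℝ × ℝ) : ℝ :=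
  Function.invFunOn (extHeight M H (rPlus M H q.2)) (Ioo (rMin M H) (2 * M)) |q.1|

section
variable {M H R : ℝ} {p : ℝ × ℝ}

/-- A leaf consists of the points of region II with `|t| = f(r)`. -/
theorem mem_image_leafCurve_iff (hM : 0 < M) (hR : R ∈ Ioo (rMin M H) (2 * M)) :
    p ∈ leafCurve M H R '' throatInterval M R ↔
      p ∈ regionII M ∧ extHeight M H R (areaRadius M p) = |timeII M p| := by
  have hR0 := pos_of_mem hM hR
  constructor
  · rintro ⟨u, hu, rfl⟩
    have hx := mem_Ico_of_mem_throatInterval hu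
    refine ⟨leafCurve_mem hM hR hu, ?_⟩
    rw [leafCurve, areaRadius_kruskalII hM (hR0.trans_le hx.1) hx.2, timeII_kruskalII hM,
      extHeight_of_le hx.1]
    have hnn := height_nonneg hM hR hx
    rw [height, add_sub_cancel_left, Real.sqrt_sq_eq_abs] at hnn ⊢
    rcases le_total 0 u with h | h
    · rw [abs_of_nonneg h] at hnn ⊢
      rw [abs_of_nonneg hnn]
    · rw [abs_of_nonpos h, heightParam_neg] at hnn ⊢
      rw [abs_of_nonpos (by linarith)]
  · rintro ⟨hp, h⟩
    have hr : areaRadius M p ∈ Ico R (2 * M) :=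
      ⟨le_of_extHeight_nonneg (h ▸ abs_nonneg _), (areaRadius_mem_Ioo hM hp).2⟩
    have hmem := sqrt_mem_throatInterval hr
    rw [extHeight_of_le hr.1] at h
    rcases le_total 0 (timeII M p) with ht | ht
    · refine ⟨_, hmem, ?_⟩
      rw [leafCurve_sqrt hr.1, h, abs_of_nonneg ht, kruskalII_areaRadius_timeII hM hp]
    · refine ⟨-√(areaRadius M p - R), ?_, ?_⟩
      · rw [mem_throatInterval, neg_sq]
        exact mem_throatInterval.1 hmem
      · rw [leafCurve_neg, leafCurve_sqrt hr.1, reflectT_kruskalII, h, abs_of_nonpos ht, neg_neg,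
          kruskalII_areaRadius_timeII hM hp]

theorem throatRadius_spec (hM : 0 < M) (hp : p ∈ regionII M) (hr : rMin M H < areaRadius M p) :
    throatRadius M H p ∈ Ioo (rMin M H) (2 * M) ∧
      extHeight M H (throatRadius M H p) (areaRadius M p) = |timeII M p| := by
  have hex := exists_throat_extHeight_eq (H := H) hM ⟨hr, (areaRadius_mem_Ioo hM hp).2⟩
    (abs_nonneg (timeII M p))
  exact ⟨Function.invFunOn_mem hex, Function.invFunOn_eq hex⟩

theorem throatRadius_eq (hM : 0 < M) (hH : -(1 / (6 * M)) ≤ H)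
    (hR : R ∈ Ioo (rMin M H) (2 * M)) (hp : p ∈ regionII M) (hr : rMin M H < areaRadius M p)
    (h : extHeight M H R (areaRadius M p) = |timeII M p|) : throatRadius M H p = R := by
  obtain ⟨h1, h2⟩ := throatRadius_spec hM hp hr
  exact (strictAntiOn_extHeight hM hH (areaRadius_mem_Ioo hM hp).2).injOn h1 hR (h2.trans h.symm)

theorem leafRadius_spec (hM : 0 < M) {q : ℝ × ℝ} (hq : q.2 ∈ Ioo (cMin M H) (-8 * M ^ 3 * H)) :
    leafRadius M H q ∈ Ioo (rMin M H) (2 * M) ∧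
      extHeight M H (rPlus M H q.2) (leafRadius M H q) = |q.1| := by
  have hex := exists_radius_extHeight_eq hM (rPlus_spec hM hq).1 (abs_nonneg q.1)
  exact ⟨Function.invFunOn_mem hex, Function.invFunOn_eq hex⟩

theorem isOpen_regionII (M : ℝ) : IsOpen (regionII M) := by
  unfold regionII
  exact (isOpen_lt continuous_fst continuous_const).inter
    ((isOpen_lt continuous_const continuous_snd).inter
      (isOpen_lt continuous_const (continuous_fst.mul continuous_snd)))

theorem continuousOn_areaRadius (hM : 0 < M) : ContinuousOn (areaRadius M) (regionII M) := by
  refine continuousOn_of_implicit (F := fun a p => p.1 * p.2 - radialProfile M a)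
    (l := 0) (u := 2 * M) ?_ ?_ (fun p hp => areaRadius_mem_Ioo hM hp) ?_
  · intro p _ a ha b hb hab
    have := radialProfile_strictMonoOn hM ha.1.le hb.1.le hab
    simp only
    linarith
  · intro a _
    fun_prop
  · intro p hp
    rw [(areaRadius_spec hM hp.2.2).2, sub_self]

theorem continuousOn_timeII (M : ℝ) : ContinuousOn (timeII M) (regionII M) := by
  unfold timeII
  apply ContinuousOn.mul continuousOn_const
  exact (ContinuousOn.log (by fun_prop) fun p hp => hp.2.1.ne').sub
    (ContinuousOn.log (by fun_prop) fun p hp => (neg_pos.2 hp.1).ne')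

/-- The part `r > r_H` of region II. -/
def outerII (M H : ℝ) : Set (ℝ × ℝ) := {p | p ∈ regionII M ∧ rMin M H < areaRadius M p}

theorem isOpen_outerII (hM : 0 < M) (H : ℝ) : IsOpen (outerII M H) :=
  (continuousOn_areaRadius hM).isOpen_inter_preimage (isOpen_regionII M) isOpen_Ioi

theorem continuousOn_throatRadius (hM : 0 < M) (hH : -(1 / (6 * M)) ≤ H) :
    ContinuousOn (throatRadius M H) (outerII M H) := by
  refine continuousOn_of_implicit
    (F := fun a p => extHeight M H a (areaRadius M p) - |timeII M p|)
    (l := rMin M H) (u := 2 * M) ?_ ?_ (fun p hp => (throatRadius_spec hM hp.1 hp.2).1) ?_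
  · intro p hp a ha b hb hab
    have := strictAntiOn_extHeight hM hH (areaRadius_mem_Ioo hM hp.1).2 ha hb hab
    simp only at this ⊢
    linarith
  · intro a ha
    exact ((continuousOn_extHeight_radius hM ha).comp
      ((continuousOn_areaRadius hM).mono fun p hp => hp.1)
      fun p hp => (areaRadius_mem_Ioo hM hp.1).2).sub
      ((continuousOn_timeII M).mono fun p hp => hp.1).abs
  · intro p hp
    rw [(throatRadius_spec hM hp.1 hp.2).2, sub_self]

theorem continuousOn_rPlus (hM : 0 < M) (H : ℝ) :
    ContinuousOn (rPlus M H) (Ioo (cMin M H) (-8 * M ^ 3 * H)) := by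
  refine continuousOn_of_implicit (F := fun a c => c - kFun M H a)
    (l := rMin M H) (u := 2 * M) ?_ ?_ (fun c hc => (rPlus_spec hM hc).1) ?_
  · intro c _ a ha b hb hab
    have := strictMonoOn_kFun hM H (Ioo_subset_Icc_self ha) (Ioo_subset_Icc_self hb) hab
    simp only
    linarith
  · intro a _
    fun_prop
  · intro c hc
    rw [(rPlus_spec hM hc).2, sub_self]

theorem continuousOn_leafRadius (hM : 0 < M) (H : ℝ) :
    ContinuousOn (leafRadius M H) (univ ×ˢ Ioo (cMin M H) (-8 * M ^ 3 * H)) := by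
  refine continuousOn_of_implicit (F := fun a q => |q.1| - extHeight M H (rPlus M H q.2) a)
    (l := rMin M H) (u := 2 * M) ?_ ?_ (fun q hq => (leafRadius_spec hM hq.2).1) ?_
  · intro q hq a ha b hb hab
    have := strictMonoOn_extHeight hM (rPlus_spec hM hq.2).1 ha.2 hb.2 hab
    simp only
    linarith
  · intro a ha
    apply ContinuousOn.sub (by fun_prop)
    exact (continuousOn_extHeight_throat hM ha.2).comp
      ((continuousOn_rPlus hM H).comp continuousOn_snd fun q hq => hq.2)
      fun q hq => (rPlus_spec hM hq.2).1
  · intro q hq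
    rw [(leafRadius_spec hM hq.2).2, sub_self]

/-- Schwarzschild time and the parameter of the leaf are global coordinates on the part `r > r_H`
of region II. -/
def leafChart (hM : 0 < M) (hH : -(1 / (6 * M)) ≤ H) :
    OpenPartialHomeomorph (ℝ × ℝ) (ℝ × ℝ) where
  toFun p := (timeII M p, kFun M H (throatRadius M H p))
  invFun q := kruskalII M (leafRadius M H q) q.1
  source := outerII M H
  target := univ ×ˢ Ioo (cMin M H) (-8 * M ^ 3 * H)
  map_source' p hp := ⟨mem_univ _, kFun_mem_Ioo hM (throatRadius_spec hM hp.1 hp.2).1⟩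
  map_target' q hq := by
    have h := (leafRadius_spec hM hq.2).1
    have h0 := (rMin_spec hM H).1.1.trans h.1
    exact ⟨kruskalII_mem hM h0 h.2 _, by rw [areaRadius_kruskalII hM h0 h.2]; exact h.1⟩
  left_inv' p hp := by
    obtain ⟨h1, h2⟩ := throatRadius_spec hM hp.1 hp.2
    have hr := areaRadius_mem_Ioo hM hp.1
    obtain ⟨h3, h4⟩ := leafRadius_spec hM
      (q := (timeII M p, kFun M H (throatRadius M H p))) (kFun_mem_Ioo hM h1)
    simp only [rPlus_kFun hM h1] at h4
    have h5 := (strictMonoOn_extHeight hM h1).injOn h3.2 hr.2 (h4.trans h2.symm)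
    simp only
    rw [h5, kruskalII_areaRadius_timeII hM hp.1]
  right_inv' q hq := by
    obtain ⟨h1, h2⟩ := leafRadius_spec hM hq.2
    obtain ⟨h3, h4⟩ := rPlus_spec hM hq.2
    have h0 := (rMin_spec hM H).1.1.trans h1.1
    have hr := areaRadius_kruskalII hM h0 h1.2 q.1
    have ht := timeII_kruskalII hM (leafRadius M H q) q.1
    have h5 : throatRadius M H (kruskalII M (leafRadius M H q) q.1) = rPlus M H q.2 :=
      throatRadius_eq hM hH h3 (kruskalII_mem hM h0 h1.2 _) (by rw [hr]; exact h1.1)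
        (by rw [hr, ht, h2])
    rw [h5, h4, ht]
  open_source := isOpen_outerII hM H
  open_target := isOpen_univ.prod isOpen_Ioo
  continuousOn_toFun := ((continuousOn_timeII M).mono fun p hp => hp.1).prodMk
    ((continuous_kFun M H).comp_continuousOn (continuousOn_throatRadius hM hH))
  continuousOn_invFun := by
    have hc := continuousOn_leafRadius hM H
    have hlog : ContinuousOn (fun q => Real.log (2 * M - leafRadius M H q))
        (univ ×ˢ Ioo (cMin M H) (-8 * M ^ 3 * H)) :=
      (continuousOn_const.sub hc).log
        fun q hq => (sub_pos.2 (leafRadius_spec hM hq.2).1.2).ne'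
    unfold kruskalII
    exact ((hlog.div_const 2).add ((hc.sub continuousOn_fst).div_const _)).rexp.neg.prodMk
      ((hlog.div_const 2).add ((hc.add continuousOn_fst).div_const _)).rexp

/-- A leaf is empty, or it is the set of points with a given throat radius. -/
theorem mem_leaf_iff (hM : 0 < M) (hH : -(1 / (6 * M)) ≤ H) {c : ℝ}
    (hc : c ∈ Ioc (cMin M H) (-8 * M ^ 3 * H)) :
    p ∈ sigmaPlus M H c ∩ regionII M ↔
      p ∈ outerII M H ∧ kFun M H (throatRadius M H p) = c := by
  rcases hc.2.eq_or_lt with rfl | hlt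
  · rw [sigmaPlus_origin_inter_regionII]
    constructor
    · exact fun h => absurd h (notMem_empty p)
    · rintro ⟨hp, h⟩
      exact absurd h (kFun_mem_Ioo hM (throatRadius_spec hM hp.1 hp.2).1).2.ne
  · obtain ⟨h3, h4⟩ := rPlus_spec hM ⟨hc.1, hlt⟩
    rw [← h4, sigmaPlus_inter_regionII hM h3, mem_image_leafCurve_iff hM h3]
    constructor
    · rintro ⟨hp, h⟩
      have hr : rMin M H < areaRadius M p :=
        h3.1.trans_le (le_of_extHeight_nonneg (h ▸ abs_nonneg _))
      exact ⟨⟨hp, hr⟩, by rw [throatRadius_eq hM hH h3 hp hr h]⟩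
    · rintro ⟨hp, h⟩
      obtain ⟨h1, h2⟩ := throatRadius_spec hM hp.1 hp.2
      rw [(strictMonoOn_kFun hM H).injOn (Ioo_subset_Icc_self h1) (Ioo_subset_Icc_self h3) h] at h2
      exact ⟨hp.1, h2⟩

theorem isTSSCMC_sigmaPlus (hM : 0 < M) (H : ℝ) {c : ℝ}
    (hc : c ∈ Ioc (cMin M H) (-8 * M ^ 3 * H)) :
    IsTSSCMC M H (sigmaPlus M H c ∩ regionII M) := by
  rcases hc.2.eq_or_lt with rfl | hlt
  · rw [sigmaPlus_origin_inter_regionII]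
    simp [IsTSSCMC, IsSSCMC]
  · obtain ⟨h3, h4⟩ := rPlus_spec hM ⟨hc.1, hlt⟩
    rw [← h4, sigmaPlus_inter_regionII hM h3]
    exact isTSSCMC_leafCurve hM h3

theorem isFoliation_sigmaPlus (hM : 0 < M) (hH : -(1 / (6 * M)) ≤ H) :
    IsFoliation (outerII M H) (Ioc (cMin M H) (-8 * M ^ 3 * H))
      (fun c => sigmaPlus M H c ∩ regionII M) where
  connected c hc := by
    rcases hc.2.eq_or_lt with rfl | hlt
    · rw [sigmaPlus_origin_inter_regionII]
      exact isPreconnected_empty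
    · obtain ⟨h3, h4⟩ := rPlus_spec hM ⟨hc.1, hlt⟩
      rw [← h4, sigmaPlus_inter_regionII hM h3]
      exact isPreconnected_Ioo.image _ (contDiffOn_leafCurve hM h3).continuousOn
  disjoint c hc c' hc' hne := by
    refine Set.disjoint_left.2 fun p hp hp' => hne ?_
    rw [← ((mem_leaf_iff hM hH hc).1 hp).2, ← ((mem_leaf_iff hM hH hc').1 hp').2]
  cover := by
    ext p
    rw [mem_iUnion₂]
    constructor
    · rintro ⟨c, hc, hp⟩
      exact ((mem_leaf_iff hM hH hc).1 hp).1
    · intro hp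
      have hc := Ioo_subset_Ioc_self (kFun_mem_Ioo hM (throatRadius_spec hM hp.1 hp.2).1)
      exact ⟨_, hc, (mem_leaf_iff hM hH hc).2 ⟨hp, rfl⟩⟩
  chart p hp := by
    refine ⟨leafChart hM hH, hp, Subset.rfl, fun c hc => ?_⟩
    ext q
    change q ∈ outerII M H ∧ q ∈ sigmaPlus M H c ∩ regionII M ↔
      q ∈ outerII M H ∧ kFun M H (throatRadius M H q) = c
    rw [mem_leaf_iff hM hH hc, ← and_assoc, and_self]

/-! ### Time reversal -/

/-- Time reversal `(U, V) ↦ (V, U)` changes the sign of the mean curvature. -/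
theorem meanCurvature_swap (M : ℝ) (u v : ℝ → ℝ) (s : ℝ) :
    meanCurvature M v u s = -meanCurvature M u v s := by
  have hr : areaRadius M (v s, u s) = areaRadius M (u s, v s) := by
    simp only [areaRadius, mul_comm (v s)]
  have hN : normalRadius M v u s = -normalRadius M u v s := by
    rw [normalRadius, normalRadius, hr]
    ring
  simp only [meanCurvature, hr, hN, mul_comm (deriv v s)]
  ring

theorem IsTSSCMC.swap {S : Set (ℝ × ℝ)} (h : IsTSSCMC M (-H) S) :
    IsTSSCMC M H (Prod.swap ⁻¹' S) := by
  refine ⟨⟨fun p hp => ?_, fun p hp => ?_⟩, fun p hp => h.2 _ hp⟩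
  · have := h.1.1 _ hp
    rwa [Prod.fst_swap, Prod.snd_swap, mul_comm p.2] at this
  · obtain ⟨O, hO, hpO, a, b, u, v, hu, hv, hd, hS⟩ := h.1.2 _ hp
    refine ⟨Prod.swap ⁻¹' O, hO.preimage continuous_swap, hpO, a, b, v, u, hv, hu,
      fun s hs => ⟨(hd s hs).2.1, (hd s hs).1, ?_⟩, ?_⟩
    · rw [meanCurvature_swap, (hd s hs).2.2, neg_neg]
    · rw [← preimage_inter, ← hS, ← Set.image_swap_eq_preimage_swap, image_image]
      rfl

theorem IsFoliation.swap {W : Set (ℝ × ℝ)} {I : Set ℝ} {L : ℝ → Set (ℝ × ℝ)}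
    (h : IsFoliation W I L) :
    IsFoliation (Prod.swap ⁻¹' W) (Neg.neg ⁻¹' I) (fun c => Prod.swap ⁻¹' L (-c)) where
  connected c hc := by
    rw [← Set.image_swap_eq_preimage_swap]
    exact (h.connected _ hc).image _ continuous_swap.continuousOn
  disjoint c hc c' hc' hne :=
    (h.disjoint hc hc' (fun e => hne (neg_injective e))).preimage _
  cover := by
    rw [← h.cover]
    ext p
    simp only [mem_iUnion₂, mem_preimage]
    constructor
    · rintro ⟨c, hc, hp⟩
      exact ⟨-c, hc, hp⟩
    · rintro ⟨c, hc, hp⟩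
      exact ⟨-c, by simpa using hc, by simpa using hp⟩
  chart p hp := by
    obtain ⟨φ, hp, hW, hL⟩ := h.chart p.swap hp
    let e : ℝ × ℝ ≃ₜ ℝ × ℝ := (Homeomorph.refl ℝ).prodCongr (Homeomorph.neg ℝ)
    refine ⟨((Homeomorph.prodComm ℝ ℝ).transOpenPartialHomeomorph φ).transHomeomorph e, hp,
      preimage_mono hW, fun c hc => ?_⟩
    ext q
    have hq : q.swap ∈ φ.source ∧ q.swap ∈ L (-c) ↔
        q.swap ∈ φ.source ∧ (φ q.swap).2 = -c := Set.ext_iff.1 (hL _ hc) q.swap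
    refine hq.trans (and_congr Iff.rfl ?_)
    change (φ q.swap).2 = -c ↔ -(φ q.swap).2 = c
    rw [neg_eq_iff_eq_neg]

theorem kTilde_eq_neg (M H r : ℝ) : kTilde M H r = -kFun M (-H) r := by
  simp only [kTilde, kFun]
  ring

theorem rMax_eq (M H : ℝ) : rMax M H = rMin M (-H) := by
  unfold rMax rMin
  congr 1
  ext r
  refine and_congr Iff.rfl ?_
  simp only [isMaxOn_iff, isMinOn_iff, kTilde_eq_neg, neg_le_neg_iff]

theorem cMax_eq (M H : ℝ) : cMax M H = -cMin M (-H) := by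
  rw [cMax, rMax_eq, kTilde_eq_neg, cMin]

open Classical in
theorem rTildeMinus_eq (M H c : ℝ) : rTildeMinus M H c = rPlus M (-H) (-c) := by
  have e : (fun r => r ∈ Ioo (rMin M (-H)) (2 * M) ∧ kTilde M H r = c) =
      fun r => r ∈ Ioo (rMin M (-H)) (2 * M) ∧ kFun M (-H) r = -c := by
    funext r
    rw [kTilde_eq_neg, neg_eq_iff_eq_neg]
  have aux : ∀ (P Q : ℝ → Prop) (x : ℝ), P = Q →
      (if h : ∃ a, P a then Classical.choose h else x) =
        if h : ∃ a, Q a then Classical.choose h else x := by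
    rintro P _ x rfl
    rfl
  rw [rTildeMinus, rPlus, rMax_eq]
  exact aux _ _ _ e

theorem tildeMinusHalf_eq (M H c r : ℝ) :
    tildeMinusHalf M H c r = (plusHalf M (-H) (-c) r).swap := by
  have hA : ∀ x, aFun (-H) (-c) x = -aFun H c x := fun x => by simp only [aFun]; ring
  have hg : fBarTilde M H c = fBar M (-H) (-c) := by
    funext x
    simp only [fBarTilde, fBar, dFun, hA, neg_sq, neg_mul, sub_neg_eq_add]
  rw [tildeMinusHalf, plusHalf, rTildeMinus_eq, hg]
  rfl

theorem sigmaTildeMinus_eq {c : ℝ} (hc : c ≠ -8 * M ^ 3 * H) :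
    sigmaTildeMinus M H c = Prod.swap ⁻¹' sigmaPlus M (-H) (-c) := by
  have hc' : -c ≠ -8 * M ^ 3 * -H := fun h => hc (by linarith)
  rw [sigmaPlus, if_neg hc', sigmaTildeMinus, rTildeMinus_eq, preimage_union,
    ← Set.image_swap_eq_preimage_swap, image_image, image_image, image_image, image_image]
  simp only [tildeMinusHalf_eq]
  rfl

theorem regionII'_eq (M : ℝ) : regionII' M = Prod.swap ⁻¹' regionII M := by
  ext p
  change (0 < p.1 ∧ p.2 < 0 ∧ -2 * M < p.1 * p.2) ↔ (p.2 < 0 ∧ 0 < p.1 ∧ -2 * M < p.2 * p.1)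
  rw [mul_comm p.2, ← and_assoc, ← and_assoc, and_comm (a := 0 < p.1)]

theorem outerII'_eq (M H : ℝ) :
    {p | p ∈ regionII' M ∧ rMax M H < areaRadius M p} = Prod.swap ⁻¹' outerII M (-H) := by
  ext p
  have hr : areaRadius M p.swap = areaRadius M p := by
    simp only [areaRadius, Prod.fst_swap, Prod.snd_swap, mul_comm]
  rw [regionII'_eq, rMax_eq]
  change _ ↔ p.swap ∈ regionII M ∧ rMin M (-H) < areaRadius M p.swap
  rw [hr]
  rfl

/-- Empty leaves may be dropped from a foliation. -/
theorem IsFoliation.restrict {W : Set (ℝ × ℝ)} {I J : Set ℝ} {L L' : ℝ → Set (ℝ × ℝ)}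
    (h : IsFoliation W I L) (hJ : J ⊆ I) (hL : ∀ c ∈ J, L' c = L c)
    (hempty : ∀ c ∈ I, c ∉ J → L c = ∅) : IsFoliation W J L' where
  connected c hc := hL c hc ▸ h.connected c (hJ hc)
  disjoint c hc c' hc' hne := by
    change Disjoint (L' c) (L' c')
    rw [hL c hc, hL c' hc']
    exact h.disjoint (hJ hc) (hJ hc') hne
  cover := by
    rw [← h.cover]
    apply Subset.antisymm
    · refine iUnion₂_subset fun c hc => ?_
      rw [hL c hc]
      exact subset_biUnion_of_mem (u := L) (hJ hc)
    · refine iUnion₂_subset fun c hc => ?_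
      by_cases hcJ : c ∈ J
      · rw [← hL c hcJ]
        exact subset_biUnion_of_mem (u := L') hcJ
      · rw [hempty c hc hcJ]
        exact empty_subset _
  chart p hp := by
    obtain ⟨φ, h1, h2, h3⟩ := h.chart p hp
    exact ⟨φ, h1, h2, fun c hc => by rw [hL c hc]; exact h3 c (hJ hc)⟩

end

end Kruskal
end

theorem mainTheorem4 (M : ℝ) (hM : 0 < M) :
    ∃ C : ℝ, 0 < C ∧
      (∀ H : ℝ, -C ≤ H →
        (∀ c ∈ Ioc (Kruskal.cMin M H) (-8 * M ^ 3 * H),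
          Kruskal.IsTSSCMC M H (Kruskal.sigmaPlus M H c ∩ Kruskal.regionII M)) ∧
        Kruskal.IsFoliation
          {p | p ∈ Kruskal.regionII M ∧ Kruskal.rMin M H < Kruskal.areaRadius M p}
          (Ioc (Kruskal.cMin M H) (-8 * M ^ 3 * H))
          (fun c => Kruskal.sigmaPlus M H c ∩ Kruskal.regionII M)) ∧
      (∀ H : ℝ, H ≤ C →
        (∀ c ∈ Ioo (-8 * M ^ 3 * H) (Kruskal.cMax M H),
          Kruskal.IsTSSCMC M H (Kruskal.sigmaTildeMinus M H c ∩ Kruskal.regionII' M)) ∧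
        Kruskal.IsFoliation
          {p | p ∈ Kruskal.regionII' M ∧ Kruskal.rMax M H < Kruskal.areaRadius M p}
          (Ioo (-8 * M ^ 3 * H) (Kruskal.cMax M H))
          (fun c => Kruskal.sigmaTildeMinus M H c ∩ Kruskal.regionII' M)) := by
  refine ⟨1 / (6 * M), by positivity, fun H hH => ⟨fun c hc =>
    Kruskal.isTSSCMC_sigmaPlus hM H hc, Kruskal.isFoliation_sigmaPlus hM hH⟩, fun H hH => ?_⟩
  have hmem : ∀ c ∈ Ioo (-8 * M ^ 3 * H) (Kruskal.cMax M H),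
      -c ∈ Ioc (Kruskal.cMin M (-H)) (-8 * M ^ 3 * -H) := by
    intro c hc
    rw [Kruskal.cMax_eq] at hc
    exact ⟨by linarith [hc.2], by linarith [hc.1]⟩
  have hleaf : ∀ c ∈ Ioo (-8 * M ^ 3 * H) (Kruskal.cMax M H),
      Kruskal.sigmaTildeMinus M H c ∩ Kruskal.regionII' M =
        Prod.swap ⁻¹' (Kruskal.sigmaPlus M (-H) (-c) ∩ Kruskal.regionII M) := by
    intro c hc
    rw [Kruskal.sigmaTildeMinus_eq hc.1.ne', Kruskal.regionII'_eq, preimage_inter]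
  refine ⟨fun c hc => ?_, ?_⟩
  · rw [hleaf c hc]
    exact (Kruskal.isTSSCMC_sigmaPlus hM (-H) (hmem c hc)).swap
  · rw [Kruskal.outerII'_eq]
    refine (Kruskal.isFoliation_sigmaPlus hM (H := -H) (by linarith)).swap.restrict
      (fun c hc => hmem c hc) hleaf fun c hc hc' => ?_
    have h : -c = -8 * M ^ 3 * -H := by
      by_contra hne
      have h1 : -c < -8 * M ^ 3 * -H := lt_of_le_of_ne hc.2 hne
      have h2 : Kruskal.cMin M (-H) < -c := hc.1
      refine hc' ⟨by linarith, ?_⟩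
      rw [Kruskal.cMax_eq]
      linarith
    simp only [h, Kruskal.sigmaPlus_origin_inter_regionII, preimage_empty]
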